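/- Let $\mathbf k$ be a commutative ring with unit and let $K$ be an abstract simplicial complex on $[m]=\{1,\dots,m\}$ (a collection of subsets of $[m]$ that is closed under taking subsets and contains $\emptyset$). **The algebra $A^*(K)$.** Let $\mathbf k(K)=\mathbf k[v_1,\dots,v_m]/(v_{i_1}\cdots v_{i_s}:\{i_1<\dots<i_s\}\notin K)$ be the face ring, and equip $\Lambda[u_1,\dots,u_m]\otimes\mathbf k(K)$ with the bigrading $\operatorname{bideg}u_i=(-1,2)$, $\operatorname{bideg}v_i=(0,2)$ and the differential $d$ that is a derivation (in the graded sense) with $du_i=v_i$, $dv_i=0$. Let $A^*(K)\subset\Lambda[u_1,\dots,u_m]\otimes\mathbf k(K)$ be the subcomplex spanned by the monomials $v_Iu_J$ with $I\in K$, $J\subset[m]$, $I\cap J=\emptyset$. It is an algebra under the product of $\Lambda[u_1,\dots,u_m]\otimes\mathbf k(K)$ followed by the projection that fixes these monomials and kills every monomial divisible by some $v_i^2$ or some $u_iv_i$. **The algebra $C^*(\mathcal Z_K)$.** Let $\mathcal Z_K=\bigcup_{J\in K}\{z\in(D^2)^m:|z_j|=1\text{ for }j\notin J\}\subset\mathbb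 C^m$ be the moment-angle complex. Decompose $D^2$ into the cells $1$, $T=S^1\setminus\{1\}$ and $D=\operatorname{int}D^2$, with characteristic maps $t\mapsto e^{2\pi it}$ on $[0,1]$ for $T$ and $(s,t)\mapsto 1-s+se^{2\pi it}$ on $[0,1]^2$ for $D$. Then $(D^2)^m$ is decomposed into $3^m$ product cells; write $D_IT_J$ for the cell with factors $D$ at the places in $I$, $T$ at those in $J$, and $1$ elsewhere. The cells contained in $\mathcal Z_K$ are the $D_IT_J$ with $I\in K$, $I\cap J=\emptyset$; the product, in the order of the factors, of the characteristic maps makes each of them a singular cube of $\mathcal Z_K$. Let $C^*(\mathcal Z_K)$ be the cellular cochains with coefficients in $\mathbf k$, with basis the dual cochains $(D_IT_J)^*$, and with the coboundary and the product induced by those (Serre's cubical cup product) of the singular cubical cochains of $\mathcal Z_K$. It is bigraded by placing $(D_IT_J)^*$ in bidegree $(-\#J,\,2(\#I+\#J))$. Write $H^{*,*}(\mathcal Z_K)$ for the bigraded cohomology of $C^*(\mathcal Z_K)$. **Theorem.** 1. Restriction of normalized singular cubical cochains of $\mathcal Z_K$ to the cells commutes with coboundaries and products (so $C^*(\mathcal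 Z_K)$ is a quotient of the singular cubical cochain algebra). 2. $A^*(K)$ and $C^*(\mathcal Z_K)$ are differential graded algebras (for the total degree, so that $\deg v_Iu_J=2\#I+\#J=\dim D_IT_J$), and the correspondence $v_Iu_J\mapsto(D_IT_J)^*$ defines an isomorphism of differential graded algebras $A^*(K)\cong C^*(\mathcal Z_K)$, which also preserves the bigradings. 3. $C^*(\mathcal Z_K)$ and $[\Lambda[u_1,\dots,u_m]\otimes\mathbf k(K),d]$ are bigraded cochain complexes, with differentials of bidegree $(1,0)$, and the linear map $(D_IT_J)^*\mapsto v_Iu_J$ induces, in each bidegree, an isomorphism of $\mathbf k$-modules $$H^{*,*}(\mathcal Z_K)\cong H^{*,*}\bigl[\Lambda[u_1,\dots,u_m]\otimes\mathbf k(K),d\bigr].$$ -/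

import Mathlib

open scoped TensorProduct

noncomputable section

namespace MomentAngle

/-! ### Differential graded algebras and bigraded complexes -/

section General

variable {k : Type*} [CommRing k] {M : Type*} [AddCommGroup M] [Module k M]

/-- `M`, with the homogeneous components `gr n`, the unit `one`, the multiplication `mul` and the
differential `d`, is a differential graded algebra over `k` (associative, unital, with a
differential of degree `+1` satisfying the graded Leibniz rule). -/
structure IsDGAlgebra (gr : ℕ → Submodule k M) (one : M) (mul : M →ₗ[k] M →ₗ[k] M)
    (d : M →ₗ[k] M) : Prop where
  isInternal : DirectSum.IsInternal gr
  one_mem : one ∈ gr 0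
  mul_mem : ∀ {p q : ℕ} {a b : M}, a ∈ gr p → b ∈ gr q → mul a b ∈ gr (p + q)
  one_mul : ∀ a : M, mul one a = a
  mul_one : ∀ a : M, mul a one = a
  mul_assoc : ∀ a b c : M, mul (mul a b) c = mul a (mul b c)
  d_mem : ∀ {p : ℕ} {a : M}, a ∈ gr p → d a ∈ gr (p + 1)
  d_d : ∀ a : M, d (d a) = 0
  leibniz : ∀ {p : ℕ} {a : M}, a ∈ gr p → ∀ b : M,
    d (mul a b) = mul (d a) b + (-1 : k) ^ p • mul a (d b)

/-- `M` is a bigraded cochain complex: the direct sum of its bihomogeneous components `gr s t`,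
with a differential of bidegree `(1, 0)`. -/
structure IsBigradedComplex (gr : ℤ → ℤ → Submodule k M) (d : M →ₗ[k] M) : Prop where
  isInternal : DirectSum.IsInternal (fun st : ℤ × ℤ => gr st.1 st.2)
  d_mem : ∀ {s t : ℤ} {a : M}, a ∈ gr s t → d a ∈ gr (s + 1) t
  d_d : ∀ a : M, d (d a) = 0

/-- The cocycles of bidegree `(s, t)`. -/
abbrev cocycles (gr : ℤ → ℤ → Submodule k M) (d : M →ₗ[k] M) (s t : ℤ) : Submodule k M :=
  gr s t ⊓ LinearMap.ker d

/-- The coboundaries of bidegree `(s, t)`, as a submodule of the cocycles. -/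
abbrev coboundaries (gr : ℤ → ℤ → Submodule k M) (d : M →ₗ[k] M) (s t : ℤ) :
    Submodule k (cocycles gr d s t) :=
  ((gr (s - 1) t).map d).comap (cocycles gr d s t).subtype

/-- The component of bidegree `(s, t)` of the cohomology of a bigraded complex. -/
abbrev bigradedCohomology (gr : ℤ → ℤ → Submodule k M) (d : M →ₗ[k] M) (s t : ℤ) : Type _ :=
  cocycles gr d s t ⧸ coboundaries gr d s t

end General

/-! ### Simplicial complexes on `[m]`, face rings and the Koszul algebra -/

/-- An abstract simplicial complex on the set `[m]`; the empty set is a simplex, and not every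
one-element subset is required to be one. -/
structure SimplicialComplexOn (m : ℕ) where
  faces : Set (Finset (Fin m))
  empty_mem : ∅ ∈ faces
  down_closed : ∀ {I J : Finset (Fin m)}, I ∈ faces → J ⊆ I → J ∈ faces

section Koszul

variable (k : Type*) [CommRing k] {m : ℕ} (K : SimplicialComplexOn m)

/-- The Stanley--Reisner ideal. -/
def faceIdeal : Ideal (MvPolynomial (Fin m) k) :=
  Ideal.span {p | ∃ I : Finset (Fin m), I ∉ K.faces ∧ p = ∏ i ∈ I, MvPolynomial.X i}

/-- The face ring (Stanley--Reisner ring) `k(K)`. -/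
def FaceRing : Type _ := MvPolynomial (Fin m) k ⧸ faceIdeal k K

instance : CommRing (FaceRing k K) :=
  inferInstanceAs (CommRing (MvPolynomial (Fin m) k ⧸ faceIdeal k K))

instance : Algebra k (FaceRing k K) :=
  inferInstanceAs (Algebra k (MvPolynomial (Fin m) k ⧸ faceIdeal k K))

/-- The quotient map `k[v_1, …, v_m] → k(K)`. -/
def faceRingMk : MvPolynomial (Fin m) k →ₐ[k] FaceRing k K :=
  Ideal.Quotient.mkₐ k (faceIdeal k K)

/-- The monomial `v ^ α` in the face ring. -/
def faceMonomial (α : Fin m →₀ ℕ) : FaceRing k K :=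
  faceRingMk k K (MvPolynomial.monomial α 1)

/-- The exponent vector of the square-free monomial `v_I`. -/
def sqfree (I : Finset (Fin m)) : Fin m →₀ ℕ := ∑ i ∈ I, Finsupp.single i 1

/-- The exterior algebra `Λ[u_1, …, u_m]`. -/
abbrev Ext (k : Type*) [CommRing k] (m : ℕ) : Type _ := ExteriorAlgebra k (Fin m → k)

/-- The exterior generator `u_i`. -/
def extGen (k : Type*) [CommRing k] {m : ℕ} (i : Fin m) : Ext k m :=
  ExteriorAlgebra.ι k (Pi.single i 1)

/-- The exterior monomial `u_J = u_{j_1} ⋯ u_{j_q}`, `j_1 < ⋯ < j_q`. -/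
def extMonomial (k : Type*) [CommRing k] {m : ℕ} (J : Finset (Fin m)) : Ext k m :=
  ((J.sort (· ≤ ·)).map (extGen k)).prod

/-- The algebra `Λ[u_1, …, u_m] ⊗ k(K)`. As `k(K)` lies in even degrees, no sign enters the
multiplication `(a ⊗ x)(b ⊗ y) = ab ⊗ xy`. -/
abbrev Koszul : Type _ := Ext k m ⊗[k] FaceRing k K

/-- The monomial `u_J v ^ α` in the algebra `Λ[u_1, …, u_m] ⊗ k(K)`. -/
def koszulMonomial (J : Finset (Fin m)) (α : Fin m →₀ ℕ) : Koszul k K :=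
  extMonomial k J ⊗ₜ[k] faceMonomial k K α

/-- The contraction `∂/∂u_i` of `Λ[u_1, …, u_m]`, an antiderivation taking `u_j` to `δ_ij`. -/
def extPartial (k : Type*) [CommRing k] {m : ℕ} (i : Fin m) : Ext k m →ₗ[k] Ext k m :=
  CliffordAlgebra.contractLeft (LinearMap.proj i : (Fin m → k) →ₗ[k] k)

theorem extPartial_one (k : Type*) [CommRing k] {m : ℕ} (i : Fin m) :
    extPartial k i (1 : Ext k m) = 0 :=
  CliffordAlgebra.contractLeft_one _ _

theorem extPartial_extGen_mul (k : Type*) [CommRing k] {m : ℕ} (i j : Fin m) (a : Ext k m) :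
    extPartial k i (extGen k j * a) =
      (if i = j then 1 else 0 : k) • a - extGen k j * extPartial k i a := by
  rw [← Pi.single_apply j (1 : k) i]
  exact CliffordAlgebra.contractLeft_ι_mul _ _ _

/-- The differential on `Λ[u_1, …, u_m] ⊗ k(K)`: the antiderivation with `d u_i = v_i` and
`d v_i = 0`, written as `∑ i, ∂/∂u_i ⊗ v_i`; see `koszulD_one_tmul` and `koszulD_u_mul` for
the fact that it is this antiderivation. -/
def koszulD : Koszul k K →ₗ[k] Koszul k K :=
  ∑ i : Fin m, TensorProduct.map (extPartial k i)
    (LinearMap.mulLeft k (faceMonomial k K (Finsupp.single i 1)))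

theorem koszulD_one_tmul (x : FaceRing k K) : koszulD k K (1 ⊗ₜ x) = 0 := by
  simp only [koszulD, LinearMap.sum_apply, TensorProduct.map_tmul, extPartial_one,
    TensorProduct.zero_tmul, Finset.sum_const_zero]

theorem koszulD_u_mul (i : Fin m) (x : Koszul k K) :
    koszulD k K ((extGen k i ⊗ₜ 1) * x) =
      (1 ⊗ₜ faceMonomial k K (Finsupp.single i 1)) * x
        - (extGen k i ⊗ₜ 1) * koszulD k K x := by
  induction x using TensorProduct.induction_on with
  | zero => simp
  | add x y hx hy => rw [mul_add, map_add, hx, hy, map_add, mul_add, mul_add]; abel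
  | tmul a y =>
    simp only [koszulD, LinearMap.sum_apply, TensorProduct.map_tmul,
      Algebra.TensorProduct.tmul_mul_tmul, one_mul, LinearMap.mulLeft_apply,
      extPartial_extGen_mul, TensorProduct.sub_tmul, Finset.sum_sub_distrib, Finset.mul_sum]
    congr 1
    rw [Finset.sum_eq_single i]
    · simp
    · intro j _ hj; simp [hj]
    · simp

/-- The component of total degree `n`, where `deg u_i = 1` and `deg v_i = 2`. -/
def koszulDegree (n : ℕ) : Submodule k (Koszul k K) :=
  Submodule.span k {x | ∃ (J : Finset (Fin m)) (α : Fin m →₀ ℕ),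
    J.card + 2 * α.degree = n ∧ x = koszulMonomial k K J α}

/-- The component of bidegree `(s, t)`, where `bideg u_i = (-1, 2)` and `bideg v_i = (0, 2)`. -/
def koszulBidegree (s t : ℤ) : Submodule k (Koszul k K) :=
  Submodule.span k {x | ∃ (J : Finset (Fin m)) (α : Fin m →₀ ℕ),
    -(J.card : ℤ) = s ∧ 2 * ((J.card : ℤ) + (α.degree : ℤ)) = t ∧ x = koszulMonomial k K J α}

/-! ### The algebra `A^*(K)` -/

/-- The submodule `A^*(K)` of `Λ[u_1, …, u_m] ⊗ k(K)` generated by the monomials `u_J v_I` with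
`I` a simplex of `K` and `I ∩ J = ∅`. -/
def A : Submodule k (Koszul k K) :=
  Submodule.span k {x | ∃ I J : Finset (Fin m), I ∈ K.faces ∧ Disjoint I J ∧
    x = koszulMonomial k K J (sqfree I)}

/-- The span of the remaining monomials: those divisible by some `v_i ^ 2` or some `u_i v_i`. -/
def nonSqfree : Submodule k (Koszul k K) :=
  Submodule.span k {x | ∃ (J : Finset (Fin m)) (α : Fin m →₀ ℕ),
    (∃ i, 2 ≤ α i ∨ (i ∈ J ∧ 1 ≤ α i)) ∧ x = koszulMonomial k K J α}

/-! #### The multiplication of `A^*(K)` is defined through the projection along `nonSqfree` -/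

theorem extMonomial_eq_basis (J : Finset (Fin m)) :
    extMonomial k J = (Pi.basisFun k (Fin m)).ExteriorAlgebra J := by
  rw [ExteriorAlgebra.basis_apply_ofCard _ (s := J) rfl, ExteriorAlgebra.ιMulti_family,
    ExteriorAlgebra.ιMulti_apply, extMonomial]
  congr 1
  refine List.ext_getElem (by simp) fun n h1 h2 => ?_
  simp only [List.getElem_map, extGen, List.getElem_ofFn, Function.comp_apply,
    Pi.basisFun_apply]
  rfl

theorem sqfree_apply (I : Finset (Fin m)) (i : Fin m) : sqfree I i = if i ∈ I then 1 else 0 := by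
  simp [sqfree, Finsupp.finsetSum_apply, Finsupp.single_apply]

theorem monomial_sqfree (I : Finset (Fin m)) :
    (MvPolynomial.monomial (sqfree I) (1 : k)) = ∏ i ∈ I, MvPolynomial.X i := by
  rw [sqfree, MvPolynomial.monomial_sum_one]
  rfl

theorem faceMonomial_sqfree_eq_zero {I : Finset (Fin m)} (hI : I ∉ K.faces) :
    faceMonomial k K (sqfree I) = 0 :=
  Ideal.Quotient.eq_zero_iff_mem.2 (Ideal.subset_span ⟨I, hI, monomial_sqfree k I⟩)

theorem faceIdeal_le_ker (I : Finset (Fin m)) (hI : I ∈ K.faces) :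
    (faceIdeal k K).restrictScalars k ≤ LinearMap.ker (MvPolynomial.lcoeff k (sqfree I)) := by
  intro p hp
  have h : faceIdeal k K = Ideal.span
      ((fun s => MvPolynomial.monomial s (1 : k)) '' (sqfree '' {I | I ∉ K.faces})) := by
    rw [faceIdeal]
    congr 1
    ext p
    simp [monomial_sqfree, eq_comm]
  rw [Submodule.restrictScalars_mem, h, MvPolynomial.mem_ideal_span_monomial_image] at hp
  by_contra hc
  obtain ⟨_, ⟨J, hJ, rfl⟩, hle⟩ := hp (sqfree I) (MvPolynomial.mem_support_iff.2 hc)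
  refine hJ (K.down_closed hI fun i hi => ?_)
  have := hle i
  rw [sqfree_apply, sqfree_apply, if_pos hi] at this
  by_contra hi'
  simp [hi'] at this

/-- The coefficient of `v_I`, for a simplex `I`, on the face ring. -/
def faceCoeff (I : Finset (Fin m)) (hI : I ∈ K.faces) : FaceRing k K →ₗ[k] k :=
  Submodule.liftQ ((faceIdeal k K).restrictScalars k) (MvPolynomial.lcoeff k (sqfree I))
    (faceIdeal_le_ker k K I hI)

theorem faceCoeff_faceMonomial (I : Finset (Fin m)) (hI : I ∈ K.faces) (α : Fin m →₀ ℕ) :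
    faceCoeff k K I hI (faceMonomial k K α) = if α = sqfree I then 1 else 0 :=
  MvPolynomial.coeff_monomial _ _ _

/-- The coefficient of `u_J v_I`, for a simplex `I`, on `Λ[u_1, …, u_m] ⊗ k(K)`. -/
def koszulCoeff (J I : Finset (Fin m)) (hI : I ∈ K.faces) : Koszul k K →ₗ[k] k :=
  LinearMap.mul' k k ∘ₗ
    TensorProduct.map ((Pi.basisFun k (Fin m)).ExteriorAlgebra.coord J) (faceCoeff k K I hI)

theorem koszulCoeff_koszulMonomial (J I : Finset (Fin m)) (hI : I ∈ K.faces)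
    (J' : Finset (Fin m)) (α : Fin m →₀ ℕ) :
    koszulCoeff k K J I hI (koszulMonomial k K J' α) =
      if J' = J ∧ α = sqfree I then 1 else 0 := by
  simp only [koszulCoeff, koszulMonomial, LinearMap.comp_apply, TensorProduct.map_tmul,
    LinearMap.mul'_apply, faceCoeff_faceMonomial, extMonomial_eq_basis, Module.Basis.coord_apply,
    Module.Basis.repr_self, Finsupp.single_apply]
  split_ifs <;> simp_all

theorem sqfree_injective : Function.Injective (sqfree (m := m)) := by
  intro I I' h
  ext i
  have := DFunLike.congr_fun h i
  simp only [sqfree_apply] at this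
  by_cases h1 : i ∈ I <;> by_cases h2 : i ∈ I' <;> simp_all

theorem span_koszulMonomial :
    Submodule.span k (Set.range fun p : Finset (Fin m) × (Fin m →₀ ℕ) =>
      koszulMonomial k K p.1 p.2) = ⊤ := by
  rw [eq_top_iff]
  rintro x -
  induction x using TensorProduct.induction_on with
  | zero => exact zero_mem _
  | add x y hx hy => exact add_mem hx hy
  | tmul a y =>
    obtain ⟨p, rfl⟩ : ∃ p, faceRingMk k K p = y := Ideal.Quotient.mk_surjective y
    have ha := (Pi.basisFun k (Fin m)).ExteriorAlgebra.mem_span a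
    induction ha using Submodule.span_induction with
    | zero => rw [TensorProduct.zero_tmul]; exact zero_mem _
    | add a b _ _ hx hy => rw [TensorProduct.add_tmul]; exact add_mem hx hy
    | smul c a _ hx => rw [← TensorProduct.smul_tmul']; exact Submodule.smul_mem _ _ hx
    | mem a ha =>
      obtain ⟨J, rfl⟩ := ha
      rw [← extMonomial_eq_basis]
      have hp := MvPolynomial.support_sum_monomial_coeff p
      rw [← hp, map_sum, TensorProduct.tmul_sum]
      refine Submodule.sum_mem _ fun α _ => ?_
      have : MvPolynomial.monomial α (p.coeff α) =
          p.coeff α • MvPolynomial.monomial α (1 : k) := by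
        rw [MvPolynomial.smul_monomial, smul_eq_mul, mul_one]
      rw [this, map_smul, TensorProduct.tmul_smul]
      exact Submodule.smul_mem _ _ (Submodule.subset_span ⟨(J, α), rfl⟩)

theorem isCompl_A : IsCompl (A k K) (nonSqfree k K) := by
  classical
  refine ⟨Submodule.disjoint_def.2 fun x hA hN => ?_, codisjoint_iff_le_sup.2 ?_⟩
  · -- all coefficients of `x` vanish, and `x` is determined by them
    have h0 : ∀ (I J : Finset (Fin m)) (hI : I ∈ K.faces), Disjoint I J →
        koszulCoeff k K J I hI x = 0 := by
      intro I J hI hIJ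
      refine (Submodule.span_le (p := LinearMap.ker (koszulCoeff k K J I hI))).2 ?_ hN
      rintro _ ⟨J', α, ⟨i, hi⟩, rfl⟩
      rw [SetLike.mem_coe, LinearMap.mem_ker, koszulCoeff_koszulMonomial, if_neg]
      rintro ⟨rfl, rfl⟩
      rw [sqfree_apply] at hi
      have := fun h => Finset.disjoint_left.1 hIJ (show i ∈ I from h)
      split_ifs at hi <;> grind
    let P : Koszul k K →ₗ[k] Koszul k K := ∑ I : Finset (Fin m), ∑ J : Finset (Fin m),
      if h : I ∈ K.faces ∧ Disjoint I J then
        (koszulCoeff k K J I h.1).smulRight (koszulMonomial k K J (sqfree I)) else 0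
    have hP : ∀ y, P y = ∑ I : Finset (Fin m), ∑ J : Finset (Fin m),
        if h : I ∈ K.faces ∧ Disjoint I J then
          koszulCoeff k K J I h.1 y • koszulMonomial k K J (sqfree I) else 0 := by
      intro y
      simp only [P, LinearMap.sum_apply]
      refine Finset.sum_congr rfl fun I _ => Finset.sum_congr rfl fun J _ => ?_
      split_ifs <;> rfl
    have hx : P x = x := by
      refine LinearMap.eqOn_span (g := LinearMap.id) ?_ hA
      rintro _ ⟨I, J, hI, hIJ, rfl⟩
      rw [hP, Finset.sum_eq_single I, Finset.sum_eq_single J, dif_pos ⟨hI, hIJ⟩,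
        koszulCoeff_koszulMonomial, if_pos ⟨rfl, rfl⟩, one_smul, LinearMap.id_apply]
      · intro J' _ hJ'
        split_ifs with h
        · rw [koszulCoeff_koszulMonomial, if_neg fun h => hJ' h.1.symm, zero_smul]
        · rfl
      · simp
      · intro I' _ hI'
        refine Finset.sum_eq_zero fun J' _ => ?_
        split_ifs with h
        · rw [koszulCoeff_koszulMonomial,
            if_neg fun h => hI' (sqfree_injective h.2).symm, zero_smul]
        · rfl
      · simp
    rw [← hx, hP]
    refine Finset.sum_eq_zero fun I _ => Finset.sum_eq_zero fun J _ => ?_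
    split_ifs with h
    · rw [h0 I J h.1 h.2, zero_smul]
    · rfl
  · rw [← span_koszulMonomial, Submodule.span_le]
    rintro _ ⟨⟨J, α⟩, rfl⟩
    by_cases hN : ∃ i, 2 ≤ α i ∨ (i ∈ J ∧ 1 ≤ α i)
    · exact Submodule.mem_sup_right (Submodule.subset_span ⟨J, α, hN, rfl⟩)
    · push Not at hN
      obtain ⟨I, rfl⟩ : ∃ I, α = sqfree I := by
        refine ⟨α.support, ?_⟩
        ext i
        have := (hN i).1
        rw [sqfree_apply]
        split_ifs with h <;> simp at h <;> omega
      by_cases hI : I ∈ K.faces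
      · refine Submodule.mem_sup_left (Submodule.subset_span ⟨I, J, hI, ?_, rfl⟩)
        refine Finset.disjoint_left.2 fun i hi hj => ?_
        have := (hN i).2 hj
        rw [sqfree_apply, if_pos hi] at this
        omega
      · have : koszulMonomial k K J (sqfree I) = 0 := by
          rw [koszulMonomial, faceMonomial_sqfree_eq_zero k K hI, TensorProduct.tmul_zero]
        simp only [this]
        exact zero_mem _

theorem extPartial_list_prod (i : Fin m) (l : List (Fin m)) (hl : l.Nodup) :
    ∃ c : k, extPartial k i (l.map (extGen k)).prod =
      if i ∈ l then c • ((l.erase i).map (extGen k)).prod else 0 := by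
  induction l with
  | nil => exact ⟨0, by simp [extPartial_one]⟩
  | cons j l ih =>
    obtain ⟨c, hc⟩ := ih hl.of_cons
    rw [List.map_cons, List.prod_cons, extPartial_extGen_mul, hc]
    by_cases hij : i = j
    · subst hij
      have : i ∉ l := (List.nodup_cons.1 hl).1
      exact ⟨1, by simp [this]⟩
    · refine ⟨-c, ?_⟩
      by_cases h : i ∈ l <;> simp [hij, h, Ne.symm hij]

theorem extPartial_extMonomial (i : Fin m) (J : Finset (Fin m)) :
    ∃ c : k, extPartial k i (extMonomial k J) =
      if i ∈ J then c • extMonomial k (J.erase i) else 0 := by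
  obtain ⟨c, hc⟩ := extPartial_list_prod k i (J.sort (· ≤ ·)) (Finset.sort_nodup _ _)
  refine ⟨c, ?_⟩
  have : (J.sort (· ≤ ·)).erase i = (J.erase i).sort (· ≤ ·) := by
    refine List.Perm.eq_of_pairwise' ?_ (Finset.pairwise_sort _ _) ?_
    · exact (Finset.pairwise_sort J (· ≤ ·)).sublist List.erase_sublist
    · refine (List.perm_ext_iff_of_nodup ((Finset.sort_nodup _ _).erase _)
        (Finset.sort_nodup _ _)).2 fun a => ?_
      rw [(Finset.sort_nodup _ _).mem_erase_iff]
      simp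
  rw [extMonomial, hc, this]
  simp [extMonomial]

theorem koszulD_mem_A {x : Koszul k K} (hx : x ∈ A k K) : koszulD k K x ∈ A k K := by
  refine (Submodule.span_le (p := (A k K).comap (koszulD k K))).2 ?_ hx
  rintro _ ⟨I, J, hI, hIJ, rfl⟩
  rw [SetLike.mem_coe, Submodule.mem_comap, koszulD, LinearMap.sum_apply]
  refine Submodule.sum_mem _ fun i _ => ?_
  rw [koszulMonomial, TensorProduct.map_tmul, LinearMap.mulLeft_apply]
  obtain ⟨c, hc⟩ := extPartial_extMonomial k i J
  rw [hc]
  split_ifs with hi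
  · have hiI : i ∉ I := fun h => Finset.disjoint_left.1 hIJ h hi
    have : faceMonomial k K (Finsupp.single i 1) * faceMonomial k K (sqfree I) =
        faceMonomial k K (sqfree (insert i I)) := by
      rw [faceMonomial, faceMonomial, faceMonomial, ← map_mul, MvPolynomial.monomial_mul,
        one_mul, sqfree, sqfree, Finset.sum_insert hiI]
    rw [this, ← TensorProduct.smul_tmul']
    refine Submodule.smul_mem _ _ ?_
    by_cases hiK : insert i I ∈ K.faces
    · refine Submodule.subset_span ⟨insert i I, J.erase i, hiK, ?_, rfl⟩
      rw [Finset.disjoint_insert_left]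
      exact ⟨Finset.notMem_erase _ _, hIJ.mono_right (Finset.erase_subset _ _)⟩
    · rw [faceMonomial_sqfree_eq_zero k K hiK, TensorProduct.tmul_zero]
      exact zero_mem _
  · rw [TensorProduct.zero_tmul]
    exact zero_mem _

/-- The projection `j_m` of `Λ[u_1, …, u_m] ⊗ k(K)` onto `A^*(K)`: it fixes the monomials in
`A^*(K)` and kills those divisible by some `v_i ^ 2` or some `u_i v_i`. -/
def projA : Koszul k K →ₗ[k] A k K :=
  Submodule.projectionOnto (A k K) (nonSqfree k K) (isCompl_A k K)

/-- The multiplication of `A^*(K)`: multiply in `Λ[u_1, …, u_m] ⊗ k(K)` and project; so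
`v_i ^ 2 = u_i v_i = 0` in `A^*(K)`. -/
def mulA : A k K →ₗ[k] A k K →ₗ[k] A k K :=
  ((LinearMap.mul k (Koszul k K)).compl₁₂ (A k K).subtype (A k K).subtype).compr₂ (projA k K)

/-- The differential of `A^*(K)`, a subcomplex of `Λ[u_1, …, u_m] ⊗ k(K)`. -/
def dA : A k K →ₗ[k] A k K :=
  (koszulD k K).restrict fun _ hx => koszulD_mem_A k K hx

/-- The monomial `v_I u_J` in `A^*(K)`. -/
def monA (I J : Finset (Fin m)) (hI : I ∈ K.faces) (hIJ : Disjoint I J) : A k K :=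
  ⟨koszulMonomial k K J (sqfree I), Submodule.subset_span ⟨I, J, hI, hIJ, rfl⟩⟩

/-- The unit of `A^*(K)`. -/
def oneA : A k K :=
  monA k K ∅ ∅ K.empty_mem (Finset.disjoint_empty_left _)

/-- `oneA` is the unit element of the ambient algebra. -/
theorem coe_oneA : (oneA k K : Koszul k K) = 1 := by
  simp [oneA, monA, koszulMonomial, extMonomial, faceMonomial, sqfree,
    Algebra.TensorProduct.one_def]

/-- The component of `A^*(K)` of total degree `n`. -/
def degreeA (n : ℕ) : Submodule k (A k K) :=
  (koszulDegree k K n).comap (A k K).subtype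

/-- The component of `A^*(K)` of bidegree `(s, t)`. -/
def bidegreeA (s t : ℤ) : Submodule k (A k K) :=
  (koszulBidegree k K s t).comap (A k K).subtype

end Koszul

/-! ### Singular cubical cochains of a topological space -/

section Cubical

variable (k : Type*) [CommRing k] (X : Type*) [TopologicalSpace X]

/-- The singular cubes `[0,1]^n → X` of all dimensions `n`. -/
abbrev Cube : Type _ := Σ n : ℕ, C(Fin n → unitInterval, X)

variable {X}

/-- A singular cube is degenerate if it does not depend on one of its coordinates. -/
def Cube.Degenerate (c : Cube X) : Prop :=
  ∃ i : Fin c.1, ∀ x y : Fin c.1 → unitInterval, (∀ j, j ≠ i → x j = y j) → c.2 x = c.2 y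

/-- The face of a singular `n`-cube in which the coordinates in `H` run freely (in their order)
and all the other coordinates are equal to `e`. -/
def Cube.face (c : Cube X) (H : Finset (Fin c.1)) (e : unitInterval) : Cube X :=
  ⟨H.card, c.2.comp ⟨fun y j => if h : j ∈ H then y ((H.orderIsoOfFin rfl).symm ⟨j, h⟩) else e, by
    refine continuous_pi fun j => ?_
    split_ifs
    · exact continuous_apply _
    · exact continuous_const⟩⟩

/-- The singular cubical coboundary: `(δ F)(σ) = F(∂σ)`, where
`∂σ = ∑ i, (-1)^i (σ|_{x_i = 1} - σ|_{x_i = 0})` with the coordinates numbered from `0`. -/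
def cubeCoboundary : (Cube X → k) →ₗ[k] (Cube X → k) where
  toFun F c := ∑ i : Fin c.1, (-1) ^ (i : ℕ) * (F (c.face {i}ᶜ 1) - F (c.face {i}ᶜ 0))
  map_add' F G := by
    funext c
    simp only [Pi.add_apply, ← Finset.sum_add_distrib]
    exact Finset.sum_congr rfl fun _ _ => by ring
  map_smul' r F := by
    funext c
    simp only [Pi.smul_apply, smul_eq_mul, RingHom.id_apply, Finset.mul_sum]
    exact Finset.sum_congr rfl fun _ _ => by ring

/-- The sign of the shuffle that lists first the elements of `H` and then the other ones. -/
def shuffleSign {n : ℕ} (H : Finset (Fin n)) : k :=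
  (-1) ^ ((Finset.univ.filter fun p : Fin n × Fin n => p.1 ∈ H ∧ p.2 ∉ H ∧ p.2 < p.1).card)

/-- Serre's cup product of singular cubical cochains:
`(F ∪ G)(σ) = ∑ H, ± F(σ with x_j = 0 for j ∉ H) G(σ with x_j = 1 for j ∈ H)`. -/
def cubeCup : (Cube X → k) →ₗ[k] (Cube X → k) →ₗ[k] (Cube X → k) :=
  LinearMap.mk₂ k
    (fun F G c => ∑ H : Finset (Fin c.1),
      shuffleSign k H * (F (c.face H 0) * G (c.face Hᶜ 1)))
    (fun F F' G => by
      funext c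
      simp only [Pi.add_apply, ← Finset.sum_add_distrib]
      exact Finset.sum_congr rfl fun _ _ => by ring)
    (fun r F G => by
      funext c
      simp only [Pi.smul_apply, smul_eq_mul, Finset.mul_sum]
      exact Finset.sum_congr rfl fun _ _ => by ring)
    (fun F G G' => by
      funext c
      simp only [Pi.add_apply, ← Finset.sum_add_distrib]
      exact Finset.sum_congr rfl fun _ _ => by ring)
    (fun r F G => by
      funext c
      simp only [Pi.smul_apply, smul_eq_mul, Finset.mul_sum]
      exact Finset.sum_congr rfl fun _ _ => by ring)

/-- The normalized cochains: those vanishing on the degenerate cubes. -/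
def IsNormalized {k : Type*} [CommRing k] (F : Cube X → k) : Prop :=
  ∀ c : Cube X, c.Degenerate → F c = 0

end Cubical

/-! ### The moment-angle complex and its cells -/

/-- The three cells of the disk `D²`: the point `1`, the open arc `T = S¹ \ {1}` and the open
disk `D`. -/
inductive CellType where
  | one : CellType
  | T : CellType
  | D : CellType
  deriving DecidableEq

namespace CellType

/-- The dimension of a cell of `D²`. -/
abbrev dim : CellType → ℕ
  | one => 0
  | T => 1
  | D => 2

/-- The cells of `D²` as subsets of `ℂ`. -/
def openCell : CellType → Set ℂ
  | one => {1}
  | T => {z | ‖z‖ = 1 ∧ z ≠ 1}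
  | D => {z | ‖z‖ < 1}

/-- The characteristic maps of the cells of `D²`: the circle is run through once
counterclockwise, starting at `1`, and `D` is the cone over it with apex `1`. -/
def charFun : (t : CellType) → (Fin t.dim → unitInterval) → ℂ
  | one, _ => 1
  | T, x => Complex.exp (2 * Real.pi * Complex.I * ((x (0 : Fin 1) : ℝ) : ℂ))
  | D, x => 1 - ((x (0 : Fin 2) : ℝ) : ℂ) + ((x (0 : Fin 2) : ℝ) : ℂ) *
      Complex.exp (2 * Real.pi * Complex.I * ((x (1 : Fin 2) : ℝ) : ℂ))

theorem continuous_charFun (t : CellType) : Continuous t.charFun := by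
  cases t <;> unfold charFun <;> fun_prop

theorem norm_charFun_of_ne {t : CellType} (ht : t ≠ D) (x : Fin t.dim → unitInterval) :
    ‖t.charFun x‖ = 1 := by
  cases t
  · simp [charFun]
  · simp [charFun, Complex.norm_exp]
  · exact absurd rfl ht

theorem norm_charFun_le (t : CellType) (x : Fin t.dim → unitInterval) : ‖t.charFun x‖ ≤ 1 := by
  by_cases ht : t = D
  · subst ht
    obtain ⟨h0, h1⟩ := (x (0 : Fin 2)).2
    have he : ‖Complex.exp (2 * Real.pi * Complex.I * ((x (1 : Fin 2) : ℝ) : ℂ))‖ = 1 := by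
      simp [Complex.norm_exp]
    have hs : ‖(1 : ℂ) - ((x (0 : Fin 2) : ℝ) : ℂ)‖ = 1 - (x (0 : Fin 2) : ℝ) := by
      rw [← Complex.ofReal_one, ← Complex.ofReal_sub, Complex.norm_real, Real.norm_eq_abs,
        abs_of_nonneg (by linarith)]
    refine (norm_add_le _ _).trans ?_
    rw [norm_mul, he, hs, Complex.norm_real, Real.norm_eq_abs, abs_of_nonneg h0]
    linarith
  · exact (norm_charFun_of_ne ht x).le

theorem existsUnique_mem_openCell {z : ℂ} (hz : ‖z‖ ≤ 1) : ∃! t : CellType, z ∈ t.openCell := by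
  by_cases h : ‖z‖ < 1
  · refine ⟨D, h, fun t ht => ?_⟩
    cases t
    · have hz1 : z = 1 := ht
      simp [hz1] at h
    · exact absurd ht.1 h.ne
    · rfl
  · have h1 : ‖z‖ = 1 := le_antisymm hz (not_lt.1 h)
    by_cases h2 : z = 1
    · refine ⟨one, h2, fun t ht => ?_⟩
      cases t
      · rfl
      · exact absurd h2 ht.2
      · exact absurd ht h
    · refine ⟨T, ⟨h1, h2⟩, fun t ht => ?_⟩
      cases t
      · exact absurd ht h2
      · rfl
      · exact absurd ht h

theorem norm_le_one_of_mem_openCell {t : CellType} {z : ℂ} (hz : z ∈ t.openCell) : ‖z‖ ≤ 1 := by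
  cases t
  · have hz1 : z = 1 := hz
    simp [hz1]
  · exact hz.1.le
  · exact (show ‖z‖ < 1 from hz).le

theorem norm_eq_one_of_mem_openCell {t : CellType} (ht : t ≠ D) {z : ℂ} (hz : z ∈ t.openCell) :
    ‖z‖ = 1 := by
  cases t
  · have hz1 : z = 1 := hz
    simp [hz1]
  · exact hz.1
  · exact absurd rfl ht

theorem bijOn_circle : Set.BijOn
    (fun x : unitInterval => Complex.exp (2 * Real.pi * Complex.I * ((x : ℝ) : ℂ)))
    {x | 0 < x ∧ x < 1} {z | ‖z‖ = 1 ∧ z ≠ 1} := by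
  have h2 : (2 * Real.pi * Complex.I : ℂ) ≠ 0 := Complex.two_pi_I_ne_zero
  refine ⟨fun x hx => ⟨by simp [Complex.norm_exp], fun h => ?_⟩, fun x hx y hy h => ?_, ?_⟩
  · obtain ⟨n, hn⟩ := Complex.exp_eq_one_iff.1 h
    rw [mul_comm] at hn
    have hn' : ((x : ℝ) : ℂ) = ((n : ℝ) : ℂ) := by
      have := mul_right_cancel₀ h2 hn
      simpa using this
    have hn'' : (x : ℝ) = n := Complex.ofReal_injective hn'
    have h0 : (0 : ℝ) < x := hx.1
    have h1 : (x : ℝ) < 1 := hx.2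
    rw [hn''] at h0 h1
    have h0' : 0 < n := by exact_mod_cast h0
    have h1' : n < 1 := by exact_mod_cast h1
    omega
  · obtain ⟨n, hn⟩ := Complex.exp_eq_exp_iff_exists_int.1 h
    have hn' : ((x : ℝ) : ℂ) = (((y : ℝ) + n : ℝ) : ℂ) := by
      refine mul_left_cancel₀ h2 ?_
      rw [hn]
      push_cast
      ring
    have hn'' : (x : ℝ) = y + n := Complex.ofReal_injective hn'
    have h0 : (0 : ℝ) < x := hx.1
    have h1 : (x : ℝ) < 1 := hx.2
    have h0' : (0 : ℝ) < y := hy.1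
    have h1' : (y : ℝ) < 1 := hy.2
    have a1 : (n : ℝ) < 1 := by linarith
    have a2 : (-1 : ℝ) < n := by linarith
    have b1 : n < 1 := by exact_mod_cast a1
    have b2 : -1 < n := by exact_mod_cast a2
    have b3 : n = 0 := by omega
    subst b3
    exact Subtype.ext (by simpa using hn'')
  · rintro z ⟨hz, hz1⟩
    have hza : Complex.exp (Complex.arg z * Complex.I) = z := by
      have := Complex.norm_mul_exp_arg_mul_I z
      rwa [hz, Complex.ofReal_one, one_mul] at this
    have hp := Real.pi_pos
    have ha : Complex.arg z ≠ 0 := by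
      intro h
      rw [h] at hza
      exact hz1 (by simpa using hza.symm)
    have l1 := Complex.neg_pi_lt_arg z
    have l2 := Complex.arg_le_pi z
    rcases lt_or_gt_of_ne ha with h | h
    · have e0 : 0 < Complex.arg z / (2 * Real.pi) + 1 := by
        rw [div_add_one (by positivity)]
        exact div_pos (by linarith) (by positivity)
      have e1 : Complex.arg z / (2 * Real.pi) + 1 < 1 := by
        have : Complex.arg z / (2 * Real.pi) < 0 := div_neg_of_neg_of_pos h (by positivity)
        linarith
      refine ⟨⟨_, e0.le, e1.le⟩, ⟨e0, e1⟩, ?_⟩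
      have : (2 * Real.pi * Complex.I * ((Complex.arg z / (2 * Real.pi) + 1 : ℝ) : ℂ)) =
          Complex.arg z * Complex.I + 2 * Real.pi * Complex.I := by
        push_cast
        have : (Real.pi : ℂ) ≠ 0 := by exact_mod_cast hp.ne'
        field_simp
      simp only [this, Complex.exp_periodic _, hza]
    · have e0 : 0 < Complex.arg z / (2 * Real.pi) := by positivity
      have e1 : Complex.arg z / (2 * Real.pi) < 1 := by
        rw [div_lt_one (by positivity)]
        linarith
      refine ⟨⟨_, e0.le, e1.le⟩, ⟨e0, e1⟩, ?_⟩
      have : (2 * Real.pi * Complex.I * ((Complex.arg z / (2 * Real.pi) : ℝ) : ℂ)) =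
          Complex.arg z * Complex.I := by
        push_cast
        have : (Real.pi : ℂ) ≠ 0 := by exact_mod_cast hp.ne'
        field_simp
      simp only [this, hza]

theorem normSq_of_norm_eq_one {e : ℂ} (he : ‖e‖ = 1) : e.re ^ 2 + e.im ^ 2 = 1 := by
  have := Complex.sq_norm e
  rw [he, Complex.normSq_apply] at this
  linarith

theorem re_lt_one {e : ℂ} (he : ‖e‖ = 1) (h1 : e ≠ 1) : e.re < 1 := by
  have h := normSq_of_norm_eq_one he
  refine lt_of_le_of_ne (by nlinarith [sq_nonneg e.im]) fun h2 => h1 (Complex.ext h2 ?_)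
  rw [h2] at h
  have : e.im ^ 2 = 0 := by linarith
  simpa using this

/-- Every point of the open disk lies on exactly one of the segments from `1` to the points of
the circle. -/
theorem bijOn_cone : Set.BijOn (fun p : ℝ × ℂ => 1 - (p.1 : ℂ) + p.1 * p.2)
    {p | (0 < p.1 ∧ p.1 < 1) ∧ ‖p.2‖ = 1 ∧ p.2 ≠ 1} {z | ‖z‖ < 1} := by
  refine ⟨?_, ?_, ?_⟩
  · rintro ⟨s, e⟩ ⟨⟨h0, h1⟩, he, he1⟩
    have a := normSq_of_norm_eq_one he
    have b := re_lt_one he he1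
    simp only at h0 h1 he he1 a b
    simp only [Set.mem_ofPred_eq]
    rw [← sq_lt_one_iff₀ (norm_nonneg _), Complex.sq_norm, Complex.normSq_apply]
    simp only [Complex.add_re, Complex.sub_re, Complex.one_re, Complex.ofReal_re, Complex.mul_re,
      Complex.ofReal_im, zero_mul, sub_zero, Complex.add_im, Complex.sub_im, Complex.one_im,
      Complex.mul_im, add_zero, zero_add]
    have h3 : 0 < s * (1 - s) * (1 - e.re) :=
      mul_pos (mul_pos h0 (by linarith)) (by linarith)
    have h4 : (1 - s + s * e.re) * (1 - s + s * e.re) + s * e.im * (s * e.im) =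
        1 - 2 * (s * (1 - s) * (1 - e.re)) := by
      linear_combination s ^ 2 * a
    linarith
  · rintro ⟨s, e⟩ ⟨⟨h0, h1⟩, he, he1⟩ ⟨s', e'⟩ ⟨⟨h0', h1'⟩, he', he1'⟩ h
    have a := normSq_of_norm_eq_one he
    have a' := normSq_of_norm_eq_one he'
    have b := re_lt_one he he1
    have b' := re_lt_one he' he1'
    have hre := congrArg Complex.re h
    have him := congrArg Complex.im h
    simp only [Complex.add_re, Complex.sub_re, Complex.one_re, Complex.ofReal_re, Complex.mul_re,
      Complex.ofReal_im, zero_mul, sub_zero, Complex.add_im, Complex.sub_im, Complex.one_im,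
      Complex.mul_im, add_zero, zero_add] at hre him h0 h1 h0' h1' a a' b b'
    have c : s * (1 - e.re) = s' * (1 - e'.re) := by linarith
    have d1 : (s * (1 - e.re)) ^ 2 + (s * e.im) ^ 2 = 2 * s * (s * (1 - e.re)) := by
      linear_combination s ^ 2 * a
    have d2 : (s' * (1 - e'.re)) ^ 2 + (s' * e'.im) ^ 2 = 2 * s' * (s' * (1 - e'.re)) := by
      linear_combination s' ^ 2 * a'
    rw [← c, ← him] at d2
    have hpos : 0 < s * (1 - e.re) := mul_pos h0 (by linarith)
    have hs : s = s' := by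
      have : 2 * s * (s * (1 - e.re)) = 2 * s' * (s * (1 - e.re)) := d1.symm.trans d2
      have := mul_right_cancel₀ hpos.ne' this
      linarith
    subst hs
    refine Prod.ext rfl (Complex.ext ?_ ?_)
    · have := mul_left_cancel₀ h0.ne' c
      simp only
      linarith
    · exact mul_left_cancel₀ h0.ne' him
  · intro z hz
    have hz' : z.re ^ 2 + z.im ^ 2 < 1 := by
      have := (sq_lt_one_iff₀ (norm_nonneg z)).2 hz
      rw [Complex.sq_norm, Complex.normSq_apply] at this
      linarith
    have hre : 0 < 1 - z.re := by nlinarith [sq_nonneg z.im]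
    obtain ⟨s, hs⟩ : ∃ s : ℝ, s * (2 * (1 - z.re)) = (1 - z.re) ^ 2 + z.im ^ 2 :=
      ⟨_, div_mul_cancel₀ _ (by positivity)⟩
    have h0 : 0 < s := by
      have : 0 < s * (2 * (1 - z.re)) := by rw [hs]; positivity
      exact pos_of_mul_pos_left this (by positivity)
    have h1 : s < 1 := by
      by_contra hc
      have := mul_le_mul_of_nonneg_right (not_lt.1 hc) (show 0 ≤ 2 * (1 - z.re) by positivity)
      nlinarith
    have hsc : (s : ℂ) ≠ 0 := by exact_mod_cast h0.ne'
    refine ⟨(s, 1 - (1 - z) / s), ⟨⟨h0, h1⟩, ?_, ?_⟩, ?_⟩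
    · have hr : (1 - (1 - z) / (s : ℂ)).re = 1 - (1 - z.re) / s := by
        simp [Complex.div_ofReal_re]
      have hi : (1 - (1 - z) / (s : ℂ)).im = z.im / s := by
        simp [Complex.div_ofReal_im]
        ring
      have : ‖1 - (1 - z) / (s : ℂ)‖ ^ 2 = 1 := by
        rw [Complex.sq_norm, Complex.normSq_apply, hr, hi]
        field_simp
        linear_combination -hs
      exact (pow_eq_one_iff_of_nonneg (norm_nonneg _) two_ne_zero).1 this
    · intro h
      have h' : (1 - z) / (s : ℂ) = 0 := by linear_combination -h
      rcases div_eq_zero_iff.1 h' with h' | h'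
      · have := congrArg Complex.re h'
        simp at this
        linarith
      · exact hsc h'
    · simp only
      field_simp
      ring

theorem bijOn_charFun (t : CellType) :
    Set.BijOn t.charFun {x | ∀ j, 0 < x j ∧ x j < 1} t.openCell := by
  cases t
  · refine ⟨fun x _ => rfl, fun x _ y _ _ => Subsingleton.elim (α := Fin 0 → unitInterval) x y,
      fun z hz => ⟨Fin.elim0, fun j => Fin.elim0 j, ?_⟩⟩
    exact (show z = 1 from hz).symm
  · refine ⟨fun x hx => bijOn_circle.mapsTo (hx (0 : Fin 1)), fun x hx y hy h => ?_,
      fun z hz => ?_⟩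
    · have := bijOn_circle.injOn (hx (0 : Fin 1)) (hy (0 : Fin 1)) h
      funext j
      rwa [Subsingleton.elim (α := Fin 1) j 0]
    · obtain ⟨x, hx, h⟩ := bijOn_circle.surjOn hz
      exact ⟨fun _ => x, fun _ => hx, h⟩
  · refine ⟨fun x hx => ?_, fun x hx y hy h => ?_, fun z hz => ?_⟩
    · exact bijOn_cone.mapsTo (x := ((x (0 : Fin 2) : ℝ), _))
        ⟨hx (0 : Fin 2), bijOn_circle.mapsTo (hx (1 : Fin 2))⟩
    · have hc : ∀ u : Fin 2 → unitInterval, (∀ j, 0 < u j ∧ u j < 1) →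
          (((u 0 : ℝ), Complex.exp (2 * Real.pi * Complex.I * ((u 1 : ℝ) : ℂ))) : ℝ × ℂ) ∈
            {p : ℝ × ℂ | (0 < p.1 ∧ p.1 < 1) ∧ ‖p.2‖ = 1 ∧ p.2 ≠ 1} :=
        fun u hu => ⟨hu 0, bijOn_circle.mapsTo (hu 1)⟩
      have := bijOn_cone.injOn (hc x hx) (hc y hy) h
      have h0 : x (0 : Fin 2) = y (0 : Fin 2) := Subtype.ext (congrArg Prod.fst this)
      have h1 : x (1 : Fin 2) = y (1 : Fin 2) :=
        bijOn_circle.injOn (hx (1 : Fin 2)) (hy (1 : Fin 2)) (congrArg Prod.snd this)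
      funext j
      match j with
      | (0 : Fin 2) => exact h0
      | (1 : Fin 2) => exact h1
    · obtain ⟨⟨s, e⟩, ⟨hs, he⟩, h⟩ := bijOn_cone.surjOn hz
      obtain ⟨t, ht, rfl⟩ := bijOn_circle.surjOn he
      refine ⟨![⟨s, hs.1.le, hs.2.le⟩, t], fun j => ?_, h⟩
      match j with
      | (0 : Fin 2) => exact hs
      | (1 : Fin 2) => exact ht

end CellType

section MomentAngleComplex

variable {m : ℕ} (K : SimplicialComplexOn m)

/-- The moment-angle block `B_J = {z ∈ (D²)^m : |z_j| = 1 for j ∉ J}`. -/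
def block (J : Finset (Fin m)) : Set (Fin m → ℂ) :=
  {z | (∀ i, ‖z i‖ ≤ 1) ∧ ∀ j, j ∉ J → ‖z j‖ = 1}

/-- The moment-angle complex `Z_K`, the union of the blocks `B_J` over the simplices `J`. -/
def momentAngle : Set (Fin m → ℂ) := ⋃ J ∈ K.faces, block J

/-- The indices of the factors of type `t` in a word. -/
def letters (w : Fin m → CellType) (t : CellType) : Finset (Fin m) :=
  Finset.univ.filter fun i => w i = t

/-- The cells `D_I T_J` of `Z_K`, as words in the letters `D`, `T`, `1`: a cell of the product
decomposition of `(D²)^m` lies in `Z_K` exactly when `I`, the set of the factors `D`, is a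
simplex of `K`. -/
abbrev Cell : Type := {w : Fin m → CellType // letters w .D ∈ K.faces}

variable {K}

/-- The dimension of a cell. -/
abbrev Cell.dim (w : Cell K) : ℕ := ∑ i, (w.1 i).dim

/-- The cell as a subset of `ℂ^m`: the product of the cells of the factors. -/
def Cell.openCell (w : Cell K) : Set (Fin m → ℂ) := {z | ∀ i, z i ∈ (w.1 i).openCell}

/-- The cells partition `Z_K`. -/
theorem mem_momentAngle_iff (z : Fin m → ℂ) :
    z ∈ momentAngle K ↔ ∃! w : Cell K, z ∈ w.openCell := by
  constructor
  · intro hz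
    obtain ⟨J, hJ, hz1, hz2⟩ := Set.mem_iUnion₂.1 hz
    choose w hw hu using fun i => CellType.existsUnique_mem_openCell (hz1 i)
    refine ⟨⟨w, K.down_closed hJ fun i hi => ?_⟩, hw,
      fun w' hw' => Subtype.ext (funext fun i => hu i _ (hw' i))⟩
    by_contra hij
    have hD : w i = .D := (Finset.mem_filter.1 hi).2
    have h := hw i
    simp only [hD] at h
    exact absurd (hz2 i hij) (show ‖z i‖ < 1 from h).ne
  · rintro ⟨w, hw, -⟩
    refine Set.mem_iUnion₂.2 ⟨_, w.2, fun i => CellType.norm_le_one_of_mem_openCell (hw i),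
      fun j hj => CellType.norm_eq_one_of_mem_openCell (fun h => hj ?_) (hw j)⟩
    simp [letters, h]

/-- The characteristic map of a cell as a function: the product, in the order of the factors,
of the characteristic maps of the cells of `D²`. -/
def Cell.charFun (w : Cell K) (x : Fin w.dim → unitInterval) : Fin m → ℂ :=
  fun i => (w.1 i).charFun fun j => x (finSigmaFinEquiv ⟨i, j⟩)

/-- The characteristic map is a bijection of the open cube with the cell. -/
theorem Cell.bijOn_charFun (w : Cell K) :
    Set.BijOn w.charFun {x | ∀ j, 0 < x j ∧ x j < 1} w.openCell := by
  refine ⟨fun x hx i => (CellType.bijOn_charFun _).mapsTo fun j => hx _,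
    fun x hx y hy h => ?_, fun z hz => ?_⟩
  · funext j
    obtain ⟨⟨i, j⟩, rfl⟩ := finSigmaFinEquiv.surjective j
    exact congrFun ((CellType.bijOn_charFun (w.1 i)).injOn (fun j => hx _) (fun j => hy _)
      (congrFun h i)) j
  · choose x hx hxz using fun i => (CellType.bijOn_charFun (w.1 i)).surjOn (hz i)
    refine ⟨fun j => x (finSigmaFinEquiv.symm j).1 (finSigmaFinEquiv.symm j).2,
      fun j => hx _ _, funext fun i => ?_⟩
    rw [← hxz i]
    refine congrArg _ (funext fun j => ?_)
    have h : ∀ p q : Σ i, Fin (w.1 i).dim, p = q → HEq (x p.1 p.2) (x q.1 q.2) := by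
      rintro p _ rfl
      rfl
    exact eq_of_heq (h _ ⟨i, j⟩ (finSigmaFinEquiv.symm_apply_apply _))

theorem Cell.charFun_mem (w : Cell K) (x : Fin w.dim → unitInterval) :
    w.charFun x ∈ momentAngle K := by
  refine Set.mem_iUnion₂.2 ⟨_, w.2, fun i => CellType.norm_charFun_le _ _, fun j hj => ?_⟩
  refine CellType.norm_charFun_of_ne (fun h => hj ?_) _
  simp [letters, h]

/-- The characteristic map of a cell, as a singular cube of the space `Z_K`. -/
def Cell.cube (w : Cell K) : Cube (momentAngle K) :=
  ⟨w.dim, fun x => ⟨w.charFun x, w.charFun_mem x⟩, by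
    refine Continuous.subtype_mk (continuous_pi fun i => ?_) _
    exact (CellType.continuous_charFun _).comp (continuous_pi fun j => continuous_apply _)⟩

/-- The cell `D_I T_J`. -/
def cellDT (I J : Finset (Fin m)) (hI : I ∈ K.faces) : Cell K :=
  ⟨fun i => if i ∈ I then .D else if i ∈ J then .T else .one, by
    convert hI
    ext i
    simp only [letters, Finset.mem_filter, Finset.mem_univ, true_and]
    split_ifs <;> simp_all⟩

/-! ### The cellular cochain algebra of `Z_K` -/

variable (k : Type*) [CommRing k] (K)

/-- The cellular cochains of `Z_K`: functions on the (finite) set of cells. -/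
abbrev CellCochain : Type _ := Cell K → k

/-- The cochain dual to a cell. -/
def dualCell (w : Cell K) : CellCochain K k := Pi.single w 1

/-- The restriction of a singular cubical cochain of the space `Z_K` to the cells. -/
def cellRestrict : (Cube (momentAngle K) → k) →ₗ[k] CellCochain K k :=
  LinearMap.funLeft k k Cell.cube

/-- The extension of a cellular cochain by zero to all the other singular cubes of `Z_K`. -/
def cellExtend : CellCochain K k →ₗ[k] (Cube (momentAngle K) → k) :=
  Function.ExtendByZero.linearMap k Cell.cube

/-- The cellular coboundary. Each face of the characteristic cube of a cell is either degenerate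
or the characteristic cube of a cell, so the characteristic cubes span a subcomplex of the
normalized singular cubical chains of `Z_K`: the cellular chain complex. The cellular coboundary
is the dual of its boundary operator. -/
def cellD : CellCochain K k →ₗ[k] CellCochain K k :=
  cellRestrict K k ∘ₗ cubeCoboundary k ∘ₗ cellExtend K k

/-- The multiplication of cellular cochains, induced by the cubical diagonal (which maps the
cellular chains to tensor products of cellular chains). -/
def cellMul : CellCochain K k →ₗ[k] CellCochain K k →ₗ[k] CellCochain K k :=
  ((cubeCup k).compl₁₂ (cellExtend K k) (cellExtend K k)).compr₂ (cellRestrict K k)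

/-- The unit: the cochain with the value `1` on every `0`-dimensional cell. -/
def cellOne : CellCochain K k := fun w => if w.dim = 0 then 1 else 0

/-- The cellular cochains of degree `n`: those supported on the `n`-dimensional cells. -/
def cellDegree (n : ℕ) : Submodule k (CellCochain K k) :=
  Submodule.span k {f | ∃ w : Cell K, w.dim = n ∧ f = dualCell K k w}

/-- The cellular cochains of bidegree `(s, t)`, where `bideg T_i = (-1, 2)` and
`bideg D_i = (0, 2)`. -/
def cellBidegree (s t : ℤ) : Submodule k (CellCochain K k) :=
  Submodule.span k {f | ∃ w : Cell K, -((letters w.1 .T).card : ℤ) = s ∧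
    2 * (((letters w.1 .T).card : ℤ) + ((letters w.1 .D).card : ℤ)) = t ∧ f = dualCell K k w}

end MomentAngleComplex

end MomentAngle

end

/-!
The characteristic map of a cell of `Z_K` is a product of the characteristic maps of the factors,
so every face of it that is used in the coboundary or in the cup product is computed factor by
factor. The side `s = 1` of the square over `D` parametrizes `T`, its other sides are collapsed to
the point `1`, and both ends of the interval over `T` are sent to `1`. Hence each such face is
degenerate or again the characteristic cube of a cell
(`Cell.exists_face_eq_or_degenerate`); as the cubes of the cells are nondegenerate and pairwise
different, restriction of normalized cochains to the cells is compatible with coboundaries and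
products. The same computation gives closed formulas: the coboundary turns a circle `T` into the
disk `D` that it bounds (`cellD_eq_sum`), and the product distributes the factors of a cell, each
one as a whole, among the two cochains (`cellMul_eq_sum`). Since `D` is even-dimensional, the signs
only involve the order of the circles.

On the algebraic side the same signs appear in the product of exterior monomials and in the
contractions `∂/∂u_i` (`extMonomial_mul`, `extPartial_extMonomial_eq`), so `v_I u_J ↦ (D_I T_J)^*`
respects products and differentials (`cellEquiv_mulA`, `cellEquiv_dA`). The span of the monomials
divisible by some `v_i ^ 2` or `u_i v_i` is a differential ideal, with quotient `A^*(K)`; this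
makes `A^*(K)`, and with it the cellular cochains, a differential graded algebra.

For the cohomology, the projection of `Λ[u_1, …, u_m] ⊗ k(K)` onto `A^*(K)` along that ideal is
homotopic to the identity. Call an index `i` a defect of a monomial if `v_i ^ 2` or `u_i v_i`
divides it. The terms of the differential of a monomial have the same defects as the monomial
itself, so writing a monomial with least defect `i` as `v_i x` and sending it to `u_i x` defines a
homotopy `h` with `d h + h d = 1` on the ideal, because `d (u_i x) = v_i x - u_i d x`
(`koszulD_koszulHomotopy_add`).
-/

noncomputable section

namespace MomentAngle

/-! ### Gradings defined by a basis -/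

theorem isInternal_span_basis {k : Type*} [CommRing k] {M : Type*} [AddCommGroup M] [Module k M]
    {ι κ : Type*} [DecidableEq κ] (b : Module.Basis ι k M) (deg : ι → κ) :
    DirectSum.IsInternal fun c : κ => Submodule.span k (b '' {i | deg i = c}) := by
  rw [DirectSum.isInternal_submodule_iff_iSupIndep_and_iSup_eq_top]
  constructor
  · intro c
    refine (b.linearIndependent.disjoint_span_image (s := {i | deg i = c})
      (t := {i | deg i ≠ c}) ?_).mono_right ?_
    · exact Set.disjoint_left.2 fun i hi hi' => hi' hi
    · refine iSup₂_le fun c' hc' => Submodule.span_mono (Set.image_mono ?_)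
      rintro i rfl
      exact hc'
  · rw [eq_top_iff, ← b.span_eq, Submodule.span_le]
    rintro _ ⟨i, rfl⟩
    exact Submodule.mem_iSup_of_mem (deg i) (Submodule.subset_span ⟨i, rfl, rfl⟩)

/-! ### Monomials of the exterior algebra -/

section Exterior

variable (k : Type*) [CommRing k] {m : ℕ}

theorem extMonomial_empty : extMonomial k (∅ : Finset (Fin m)) = 1 := by
  simp [extMonomial]

theorem extMonomial_insert {a : Fin m} {J : Finset (Fin m)} (h : ∀ j ∈ J, a < j) :
    extMonomial k (insert a J) = extGen k a * extMonomial k J := by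
  have ha : a ∉ J := fun h' => lt_irrefl _ (h a h')
  rw [extMonomial, Finset.sort_insert _ (fun b hb => (h b hb).le) ha, List.map_cons,
    List.prod_cons, extMonomial]

theorem extGen_mul_self (a : Fin m) : extGen k a * extGen k a = 0 :=
  ExteriorAlgebra.ι_sq_zero _

theorem extGen_mul_comm (a b : Fin m) : extGen k a * extGen k b = -(extGen k b * extGen k a) :=
  eq_neg_of_add_eq_zero_left (ExteriorAlgebra.ι_add_mul_swap _ _)

/-- Moving `u_a` to its place in an exterior monomial: the sign counts the generators it passes. -/
theorem extGen_mul_extMonomial (a : Fin m) (J : Finset (Fin m)) :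
    extGen k a * extMonomial k J =
      if a ∈ J then 0 else
        (-1 : k) ^ (J.filter (· < a)).card • extMonomial k (insert a J) := by
  induction J using Finset.induction_on_min with
  | empty => simp [← extMonomial_insert k (a := a) (J := ∅) (by simp)]
  | insert b J hb ih =>
    have hbJ : b ∉ J := fun h' => lt_irrefl _ (hb b h')
    rw [extMonomial_insert k hb, ← mul_assoc]
    rcases lt_trichotomy a b with hab | rfl | hab
    · have h1 : a ∉ insert b J := by
        intro h
        rcases Finset.mem_insert.1 h with rfl | h
        · exact lt_irrefl _ hab
        · exact lt_asymm hab (hb a h)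
      have h2 : (insert b J).filter (· < a) = ∅ := by
        refine Finset.filter_eq_empty_iff.2 fun j hj hja => ?_
        rcases Finset.mem_insert.1 hj with rfl | hj
        · exact lt_asymm hab hja
        · exact lt_asymm (hab.trans (hb j hj)) hja
      rw [if_neg h1, h2, Finset.card_empty, pow_zero, one_smul, extMonomial_insert k (a := a),
        extMonomial_insert k hb, mul_assoc]
      intro j hj
      rcases Finset.mem_insert.1 hj with rfl | hj
      · exact hab
      · exact hab.trans (hb j hj)
    · simp [extGen_mul_self]
    · rw [extGen_mul_comm, neg_mul, mul_assoc, ih]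
      by_cases haJ : a ∈ J
      · simp [haJ]
      · have h1 : a ∉ insert b J := by
          simp [haJ, hab.ne']
        rw [if_neg haJ, if_neg h1, Finset.filter_insert, if_pos hab, Finset.card_insert_of_notMem
          (by simp [hbJ]), pow_succ, Finset.insert_comm,
          extMonomial_insert k (a := b) (J := insert a J)]
        · simp
        · intro j hj
          rcases Finset.mem_insert.1 hj with rfl | hj
          · exact hab
          · exact hb j hj

/-- The product of two exterior monomials; the sign counts the inversions between the factors. -/
theorem extMonomial_mul (J J' : Finset (Fin m)) :
    extMonomial k J * extMonomial k J' =
      if Disjoint J J' then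
        (-1 : k) ^ ((J ×ˢ J').filter fun p => p.2 < p.1).card • extMonomial k (J ∪ J')
      else 0 := by
  induction J using Finset.induction_on_min with
  | empty => simp [extMonomial_empty]
  | insert a J ha ih =>
    have haJ : a ∉ J := fun h' => lt_irrefl _ (ha a h')
    rw [extMonomial_insert k ha, mul_assoc, ih]
    by_cases hJ : Disjoint J J'
    · rw [if_pos hJ, mul_smul_comm, extGen_mul_extMonomial]
      by_cases haJ' : a ∈ J'
      · simp [haJ']
      · have h2 : (J ∪ J').filter (· < a) = J'.filter (· < a) := by
          rw [Finset.filter_union, Finset.filter_eq_empty_iff.2, Finset.empty_union]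
          exact fun j hj => (ha j hj).not_gt
        have h3 : ((insert a J ×ˢ J').filter fun p => p.2 < p.1).card =
            (J'.filter (· < a)).card + ((J ×ˢ J').filter fun p => p.2 < p.1).card := by
          simp only [Finset.card_filter, Finset.sum_product, Finset.sum_insert haJ]
        rw [if_neg (by simp [haJ, haJ']), if_pos (by simp [hJ, haJ']), h2, h3, smul_smul,
          ← pow_add, Finset.insert_union, add_comm]
    · rw [if_neg hJ, if_neg (by simp [hJ]), mul_zero]

theorem extPartial_extMonomial_eq (i : Fin m) (J : Finset (Fin m)) :
    extPartial k i (extMonomial k J) =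
      if i ∈ J then (-1 : k) ^ (J.filter (· < i)).card • extMonomial k (J.erase i) else 0 := by
  induction J using Finset.induction_on_min with
  | empty => simp [extMonomial_empty, extPartial_one]
  | insert a J ha ih =>
    have haJ : a ∉ J := fun h' => lt_irrefl _ (ha a h')
    rw [extMonomial_insert k ha, extPartial_extGen_mul, ih]
    by_cases hia : i = a
    · subst hia
      have h2 : (insert i J).filter (· < i) = ∅ := by
        refine Finset.filter_eq_empty_iff.2 fun j hj hja => ?_
        rcases Finset.mem_insert.1 hj with rfl | hj
        · exact lt_irrefl _ hja
        · exact lt_asymm (ha j hj) hja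
      simp [haJ, h2]
    · by_cases hi : i ∈ J
      · have h3 : a ∉ J.filter (· < i) := by simp [haJ]
        have h4 : (insert a J).erase i = insert a (J.erase i) :=
          Finset.erase_insert_of_ne (Ne.symm hia)
        rw [if_neg hia, if_pos hi, if_pos (by simp [hi]), Finset.filter_insert, if_pos (ha i hi),
          Finset.card_insert_of_notMem h3, h4, extMonomial_insert k (a := a), pow_succ]
        · simp
        · exact fun j hj => ha j (Finset.mem_of_mem_erase hj)
      · simp [hia, hi]

end Exterior

/-! ### The differential of the Koszul algebra -/

section Koszul

variable (k : Type*) [CommRing k] {m : ℕ} (K : SimplicialComplexOn m)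

theorem faceMonomial_mul (α β : Fin m →₀ ℕ) :
    faceMonomial k K α * faceMonomial k K β = faceMonomial k K (α + β) := by
  rw [faceMonomial, faceMonomial, faceMonomial, ← map_mul, MvPolynomial.monomial_mul, one_mul]

/-- A monomial whose support is not a simplex is zero in the face ring. -/
theorem faceMonomial_eq_zero {α : Fin m →₀ ℕ} (h : α.support ∉ K.faces) :
    faceMonomial k K α = 0 := by
  have hle : sqfree α.support ≤ α := by
    intro i
    rw [sqfree_apply]
    split_ifs with hi
    · exact Nat.one_le_iff_ne_zero.2 (Finsupp.mem_support_iff.1 hi)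
    · exact Nat.zero_le _
  rw [← add_tsub_cancel_of_le hle, ← faceMonomial_mul, faceMonomial_sqfree_eq_zero k K h, zero_mul]

theorem koszulD_face_mul (y : FaceRing k K) (x : Koszul k K) :
    koszulD k K ((1 ⊗ₜ y) * x) = (1 ⊗ₜ y) * koszulD k K x := by
  induction x using TensorProduct.induction_on with
  | zero => simp
  | add x y hx hy => rw [mul_add, map_add, hx, hy, map_add, mul_add]
  | tmul a z =>
    simp only [koszulD, LinearMap.sum_apply, TensorProduct.map_tmul,
      Algebra.TensorProduct.tmul_mul_tmul, one_mul, LinearMap.mulLeft_apply, Finset.mul_sum]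
    exact Finset.sum_congr rfl fun i _ => by rw [mul_left_comm]

theorem tmul_cons (i : Fin m) (l : List (Fin m)) (y : FaceRing k K) :
    ((((i :: l).map (extGen k)).prod ⊗ₜ y : Koszul k K)) =
      (extGen k i ⊗ₜ 1) * ((l.map (extGen k)).prod ⊗ₜ y) := by
  rw [List.map_cons, List.prod_cons, Algebra.TensorProduct.tmul_mul_tmul, one_mul]

/-- The graded Leibniz rule, for a left factor that is a monomial in the exterior variables with a
coefficient in the face ring. -/
theorem koszulD_list_mul (l : List (Fin m)) (y : FaceRing k K) (x : Koszul k K) :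
    koszulD k K (((l.map (extGen k)).prod ⊗ₜ y) * x) =
      koszulD k K ((l.map (extGen k)).prod ⊗ₜ y) * x +
        (-1 : k) ^ l.length • (((l.map (extGen k)).prod ⊗ₜ y) * koszulD k K x) := by
  induction l with
  | nil => simp [koszulD_face_mul, koszulD_one_tmul]
  | cons i l ih =>
    rw [tmul_cons, mul_assoc, koszulD_u_mul, ih, koszulD_u_mul, List.length_cons, pow_succ,
      sub_mul, mul_add, mul_smul_comm, mul_assoc, mul_assoc, mul_assoc, mul_neg_one, neg_smul]
    abel

theorem koszulD_list_d (l : List (Fin m)) (y : FaceRing k K) :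
    koszulD k K (koszulD k K ((l.map (extGen k)).prod ⊗ₜ y)) = 0 := by
  induction l with
  | nil => simp [koszulD_one_tmul]
  | cons i l ih =>
    rw [tmul_cons, koszulD_u_mul, map_sub, koszulD_face_mul, koszulD_u_mul, ih, mul_zero, sub_zero,
      sub_self]

theorem koszulD_koszulD (x : Koszul k K) : koszulD k K (koszulD k K x) = 0 := by
  have hx : x ∈ Submodule.span k (Set.range fun p : Finset (Fin m) × (Fin m →₀ ℕ) =>
      koszulMonomial k K p.1 p.2) := span_koszulMonomial k K ▸ Submodule.mem_top
  induction hx using Submodule.span_induction with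
  | zero => simp
  | add x y _ _ hx hy => rw [map_add, map_add, hx, hy, add_zero]
  | smul c x _ hx => rw [map_smul, map_smul, hx, smul_zero]
  | mem x hx =>
    obtain ⟨p, rfl⟩ := hx
    exact koszulD_list_d k K _ _

theorem koszulD_mul {p : ℕ} {a : Koszul k K} (ha : a ∈ koszulDegree k K p) (b : Koszul k K) :
    koszulD k K (a * b) = koszulD k K a * b + (-1 : k) ^ p • (a * koszulD k K b) := by
  induction ha using Submodule.span_induction with
  | zero => simp
  | add x y _ _ hx hy =>
    rw [add_mul, map_add, hx, hy, map_add, add_mul, add_mul, smul_add]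
    abel
  | smul c x _ hx =>
    rw [smul_mul_assoc, map_smul, hx, map_smul, smul_mul_assoc, smul_mul_assoc, smul_add,
      smul_comm c]
  | mem x hx =>
    obtain ⟨J, α, rfl, rfl⟩ := hx
    have := koszulD_list_mul k K (J.sort (· ≤ ·)) (faceMonomial k K α) b
    rw [Finset.length_sort] at this
    rw [pow_add, pow_mul, neg_one_sq, one_pow, mul_one]
    exact this

theorem koszulD_koszulMonomial (J : Finset (Fin m)) (α : Fin m →₀ ℕ) :
    koszulD k K (koszulMonomial k K J α) = ∑ i ∈ J, (-1 : k) ^ (J.filter (· < i)).card •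
      koszulMonomial k K (J.erase i) (α + Finsupp.single i 1) := by
  rw [koszulD, LinearMap.sum_apply, ← Finset.sum_subset (Finset.subset_univ J)]
  · refine Finset.sum_congr rfl fun i hi => ?_
    rw [koszulMonomial, TensorProduct.map_tmul, extPartial_extMonomial_eq, if_pos hi,
      LinearMap.mulLeft_apply, faceMonomial_mul, ← TensorProduct.smul_tmul', koszulMonomial,
      add_comm α]
  · intro i _ hi
    rw [koszulMonomial, TensorProduct.map_tmul, extPartial_extMonomial_eq, if_neg hi,
      TensorProduct.zero_tmul]

theorem koszulMonomial_mul (J J' : Finset (Fin m)) (α α' : Fin m →₀ ℕ) :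
    koszulMonomial k K J α * koszulMonomial k K J' α' =
      if Disjoint J J' then
        (-1 : k) ^ ((J ×ˢ J').filter fun p => p.2 < p.1).card •
          koszulMonomial k K (J ∪ J') (α + α')
      else 0 := by
  rw [koszulMonomial, koszulMonomial, Algebra.TensorProduct.tmul_mul_tmul, extMonomial_mul,
    faceMonomial_mul]
  split_ifs
  · rw [koszulMonomial, TensorProduct.smul_tmul']
  · rw [TensorProduct.zero_tmul]

/-! ### The monomial basis of the Koszul algebra -/

/-- The face ideal is a monomial ideal: it contains only polynomials without terms supported on a
simplex. -/
theorem monomial_coeff_eq_zero_of_mem_faceIdeal {α : Fin m →₀ ℕ} (hα : α.support ∈ K.faces)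
    {p : MvPolynomial (Fin m) k} (hp : p ∈ faceIdeal k K) : p.coeff α = 0 := by
  have h : faceIdeal k K = Ideal.span
      ((fun s => MvPolynomial.monomial s (1 : k)) '' (sqfree '' {I | I ∉ K.faces})) := by
    rw [faceIdeal]
    congr 1
    ext p
    simp [monomial_sqfree, eq_comm]
  rw [h, MvPolynomial.mem_ideal_span_monomial_image] at hp
  by_contra hc
  obtain ⟨_, ⟨J, hJ, rfl⟩, hle⟩ := hp α (MvPolynomial.mem_support_iff.2 hc)
  refine hJ (K.down_closed hα fun i hi => ?_)
  have := hle i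
  rw [sqfree_apply, if_pos hi] at this
  exact Finsupp.mem_support_iff.2 (by omega)

theorem linearIndependent_faceMonomial :
    LinearIndependent k fun α : {α : Fin m →₀ ℕ // α.support ∈ K.faces} =>
      faceMonomial k K α := by
  classical
  rw [linearIndependent_iff']
  intro s g hg α hα
  have h1 : faceRingMk k K (∑ β ∈ s, g β • MvPolynomial.monomial (β : Fin m →₀ ℕ) (1 : k)) = 0 := by
    rw [map_sum, ← hg]
    exact Finset.sum_congr rfl fun β _ => map_smul _ _ _
  have h2 := monomial_coeff_eq_zero_of_mem_faceIdeal k K α.2 (Ideal.Quotient.eq_zero_iff_mem.1 h1)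
  simpa [MvPolynomial.coeff_sum, MvPolynomial.coeff_smul, MvPolynomial.coeff_monomial,
    Subtype.coe_inj, hα] using h2

theorem span_faceMonomial :
    ⊤ ≤ Submodule.span k (Set.range fun α : {α : Fin m →₀ ℕ // α.support ∈ K.faces} =>
      faceMonomial k K α) := by
  rintro y -
  obtain ⟨p, rfl⟩ : ∃ p, faceRingMk k K p = y := Ideal.Quotient.mk_surjective y
  rw [← MvPolynomial.support_sum_monomial_coeff p, map_sum]
  refine Submodule.sum_mem _ fun α _ => ?_
  have : MvPolynomial.monomial α (p.coeff α) =
      p.coeff α • MvPolynomial.monomial α (1 : k) := by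
    rw [MvPolynomial.smul_monomial, smul_eq_mul, mul_one]
  rw [this, map_smul]
  refine Submodule.smul_mem _ _ ?_
  by_cases hα : α.support ∈ K.faces
  · exact Submodule.subset_span ⟨⟨α, hα⟩, rfl⟩
  · have := faceMonomial_eq_zero k K hα
    rw [faceMonomial] at this
    rw [this]
    exact zero_mem _

/-- The basis of `Λ[u_1, …, u_m] ⊗ k(K)` formed by the monomials `u_J v ^ α` for which the
support of `α` is a simplex of `K`. -/
def koszulBasis :
    Module.Basis (Finset (Fin m) × {α : Fin m →₀ ℕ // α.support ∈ K.faces}) k (Koszul k K) :=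
  ((Pi.basisFun k (Fin m)).ExteriorAlgebra).tensorProduct
    (Module.Basis.mk (linearIndependent_faceMonomial k K) (span_faceMonomial k K))

theorem koszulBasis_apply (p : Finset (Fin m) × {α : Fin m →₀ ℕ // α.support ∈ K.faces}) :
    koszulBasis k K p = koszulMonomial k K p.1 p.2 := by
  rw [koszulBasis, Module.Basis.tensorProduct_apply', Module.Basis.mk_apply, koszulMonomial,
    extMonomial_eq_basis]

theorem koszulMonomial_eq_zero (J : Finset (Fin m)) {α : Fin m →₀ ℕ} (h : α.support ∉ K.faces) :
    koszulMonomial k K J α = 0 := by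
  rw [koszulMonomial, faceMonomial_eq_zero k K h, TensorProduct.tmul_zero]

theorem isInternal_koszulBidegree :
    DirectSum.IsInternal fun st : ℤ × ℤ => koszulBidegree k K st.1 st.2 := by
  suffices h : (fun st : ℤ × ℤ => koszulBidegree k K st.1 st.2) = fun c =>
      Submodule.span k (koszulBasis k K ''
        {p | (-(p.1.card : ℤ), 2 * ((p.1.card : ℤ) + (p.2.1.degree : ℤ))) = c}) by
    rw [h]
    exact isInternal_span_basis _ _
  funext st
  refine le_antisymm (Submodule.span_le.2 ?_) (Submodule.span_mono ?_)
  · rintro _ ⟨J, α, h1, h2, rfl⟩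
    by_cases hα : α.support ∈ K.faces
    · exact Submodule.subset_span ⟨(J, ⟨α, hα⟩), Prod.ext h1 h2, koszulBasis_apply k K _⟩
    · rw [koszulMonomial_eq_zero k K J hα]
      exact zero_mem _
  · rintro _ ⟨⟨J, α⟩, h, rfl⟩
    exact ⟨J, α, congrArg Prod.fst h, congrArg Prod.snd h, koszulBasis_apply k K _⟩

theorem koszulD_mem_koszulBidegree {s t : ℤ} {a : Koszul k K} (ha : a ∈ koszulBidegree k K s t) :
    koszulD k K a ∈ koszulBidegree k K (s + 1) t := by
  refine (Submodule.span_le (p := (koszulBidegree k K (s + 1) t).comap (koszulD k K))).2 ?_ ha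
  rintro _ ⟨J, α, rfl, rfl, rfl⟩
  rw [SetLike.mem_coe, Submodule.mem_comap, koszulD_koszulMonomial]
  refine Submodule.sum_mem _ fun i hi => Submodule.smul_mem _ _ (Submodule.subset_span ?_)
  have hc := Finset.card_erase_add_one hi
  refine ⟨_, _, ?_, ?_, rfl⟩
  · omega
  · rw [map_add, Finsupp.degree_single]
    push_cast
    omega

theorem koszulD_mem_koszulDegree {p : ℕ} {a : Koszul k K} (ha : a ∈ koszulDegree k K p) :
    koszulD k K a ∈ koszulDegree k K (p + 1) := by
  refine (Submodule.span_le (p := (koszulDegree k K (p + 1)).comap (koszulD k K))).2 ?_ ha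
  rintro _ ⟨J, α, rfl, rfl⟩
  rw [SetLike.mem_coe, Submodule.mem_comap, koszulD_koszulMonomial]
  refine Submodule.sum_mem _ fun i hi => Submodule.smul_mem _ _ (Submodule.subset_span ?_)
  have hc := Finset.card_erase_add_one hi
  refine ⟨_, _, ?_, rfl⟩
  rw [map_add, Finsupp.degree_single]
  omega

theorem mul_mem_koszulDegree {p q : ℕ} {a b : Koszul k K} (ha : a ∈ koszulDegree k K p)
    (hb : b ∈ koszulDegree k K q) : a * b ∈ koszulDegree k K (p + q) := by
  induction ha, hb using Submodule.span_induction₂ with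
  | mem_mem x y hx hy =>
    obtain ⟨J, α, rfl, rfl⟩ := hx
    obtain ⟨J', α', rfl, rfl⟩ := hy
    rw [koszulMonomial_mul]
    split_ifs with h
    · refine Submodule.smul_mem _ _ (Submodule.subset_span ⟨_, _, ?_, rfl⟩)
      rw [Finset.card_union_of_disjoint h, map_add]
      ring
    · exact zero_mem _
  | zero_left y _ => rw [zero_mul]; exact zero_mem _
  | zero_right x _ => rw [mul_zero]; exact zero_mem _
  | add_left x y z _ _ _ h1 h2 => rw [add_mul]; exact add_mem h1 h2
  | add_right x y z _ _ _ h1 h2 => rw [mul_add]; exact add_mem h1 h2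
  | smul_left r x y _ _ h => rw [smul_mul_assoc]; exact Submodule.smul_mem _ _ h
  | smul_right r x y _ _ h => rw [mul_smul_comm]; exact Submodule.smul_mem _ _ h

end Koszul

section Projection

variable (k : Type*) [CommRing k] {m : ℕ} (K : SimplicialComplexOn m)

/-! ### The complement of `A^*(K)` and the projection onto `A^*(K)` -/

/-- The indices `i` for which `v_i ^ 2` or `u_i v_i` divides the monomial `u_J v ^ α`. -/
def defectSet {m : ℕ} (J : Finset (Fin m)) (α : Fin m →₀ ℕ) : Finset (Fin m) :=
  Finset.univ.filter fun i => 2 ≤ α i ∨ (i ∈ J ∧ 1 ≤ α i)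

theorem mem_defectSet {J : Finset (Fin m)} {α : Fin m →₀ ℕ} {i : Fin m} :
    i ∈ defectSet J α ↔ 2 ≤ α i ∨ (i ∈ J ∧ 1 ≤ α i) := by
  simp [defectSet]

/-- The defect set does not change when a factor `u_j` is replaced by `v_j`: if `v_j` divides the
rest of the monomial, then `u_j v_j` becomes `v_j ^ 2`, and otherwise `j` is no defect before or
after. Therefore the differential preserves defect sets. -/
theorem defectSet_erase {J : Finset (Fin m)} {α : Fin m →₀ ℕ} {j : Fin m} (hj : j ∈ J) :
    defectSet (J.erase j) (α + Finsupp.single j 1) = defectSet J α := by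
  ext i
  by_cases hij : i = j
  · subst hij
    simp [mem_defectSet, hj]
    omega
  · simp [mem_defectSet, hij, Finsupp.single_eq_of_ne hij]

theorem defectSet_sqfree {I J : Finset (Fin m)} (hIJ : Disjoint I J) :
    defectSet J (sqfree I) = ∅ := by
  refine Finset.eq_empty_of_forall_notMem fun i hi => ?_
  rw [mem_defectSet, sqfree_apply] at hi
  split_ifs at hi with h
  · exact Finset.disjoint_left.1 hIJ h (by simpa using hi)
  · simp at hi

/-- A monomial without defects has the form `v_I u_J` with `I` and `J` disjoint. -/
theorem eq_sqfree_of_defectSet_eq_empty {J : Finset (Fin m)} {α : Fin m →₀ ℕ}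
    (h : defectSet J α = ∅) : α = sqfree α.support ∧ Disjoint α.support J := by
  have h' : ∀ i, ¬ (2 ≤ α i ∨ (i ∈ J ∧ 1 ≤ α i)) := fun i hi => by
    have := mem_defectSet.2 hi
    simp [h] at this
  constructor
  · ext i
    have := h' i
    rw [sqfree_apply]
    split_ifs with hi <;> simp at hi <;> omega
  · refine Finset.disjoint_left.2 fun i hi hj => h' i (Or.inr ⟨hj, ?_⟩)
    exact Nat.one_le_iff_ne_zero.2 (Finsupp.mem_support_iff.1 hi)

theorem koszulMonomial_mem_nonSqfree {J : Finset (Fin m)} {α : Fin m →₀ ℕ}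
    (h : (defectSet J α).Nonempty) : koszulMonomial k K J α ∈ nonSqfree k K := by
  obtain ⟨i, hi⟩ := h
  exact Submodule.subset_span ⟨J, α, ⟨i, mem_defectSet.1 hi⟩, rfl⟩

theorem koszulMonomial_mem_A {J : Finset (Fin m)} {α : Fin m →₀ ℕ} (h : defectSet J α = ∅) :
    koszulMonomial k K J α ∈ A k K := by
  obtain ⟨h1, h2⟩ := eq_sqfree_of_defectSet_eq_empty h
  by_cases hα : α.support ∈ K.faces
  · exact Submodule.subset_span ⟨α.support, J, hα, h2, by rw [← h1]⟩
  · rw [koszulMonomial_eq_zero k K J hα]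
    exact zero_mem _

/-- Two linear maps on the Koszul algebra are equal if they agree on all monomials. -/
theorem koszul_hom_ext {M : Type*} [AddCommGroup M] [Module k M] {f g : Koszul k K →ₗ[k] M}
    (h : ∀ J α, f (koszulMonomial k K J α) = g (koszulMonomial k K J α)) : f = g := by
  refine LinearMap.ext_on_range (span_koszulMonomial k K) fun p => h p.1 p.2

theorem projA_of_mem {x : Koszul k K} (hx : x ∈ A k K) : (projA k K x : Koszul k K) = x :=
  congrArg Subtype.val
    (Submodule.projectionOnto_apply_left (h := isCompl_A k K) (x := ⟨x, hx⟩))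

theorem projA_coe (a : A k K) : projA k K a = a :=
  Subtype.ext (projA_of_mem k K a.2)

theorem projA_eq_zero_iff {x : Koszul k K} : projA k K x = 0 ↔ x ∈ nonSqfree k K :=
  Submodule.projectionOnto_apply_eq_zero_iff (isCompl_A k K)

theorem sub_projA_mem (x : Koszul k K) : x - projA k K x ∈ nonSqfree k K := by
  rw [← projA_eq_zero_iff, map_sub, projA_coe, sub_self]

theorem projA_congr {x y : Koszul k K} (h : x - y ∈ nonSqfree k K) : projA k K x = projA k K y := by
  rw [← sub_eq_zero, ← map_sub, projA_eq_zero_iff]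
  exact h

theorem projA_koszulMonomial (J : Finset (Fin m)) (α : Fin m →₀ ℕ) :
    (projA k K (koszulMonomial k K J α) : Koszul k K) =
      if defectSet J α = ∅ then koszulMonomial k K J α else 0 := by
  split_ifs with h
  · exact projA_of_mem k K (koszulMonomial_mem_A k K h)
  · rw [(projA_eq_zero_iff k K).2 (koszulMonomial_mem_nonSqfree k K
      (Finset.nonempty_iff_ne_empty.2 h)), ZeroMemClass.coe_zero]

/-- The projection onto `A^*(K)` takes each monomial to itself or to zero, so it preserves every
span of monomials; in particular it preserves degrees. -/
theorem projA_mem_span {P : Finset (Fin m) → (Fin m →₀ ℕ) → Prop} {x : Koszul k K}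
    (hx : x ∈ Submodule.span k {x | ∃ J α, P J α ∧ x = koszulMonomial k K J α}) :
    (projA k K x : Koszul k K) ∈
      Submodule.span k {x | ∃ J α, P J α ∧ x = koszulMonomial k K J α} := by
  refine (Submodule.span_le (p := (Submodule.span k
    {x | ∃ J α, P J α ∧ x = koszulMonomial k K J α}).comap
      ((A k K).subtype ∘ₗ projA k K))).2 ?_ hx
  rintro _ ⟨J, α, h, rfl⟩
  rw [SetLike.mem_coe, Submodule.mem_comap, LinearMap.comp_apply, Submodule.subtype_apply,
    projA_koszulMonomial]
  split_ifs
  · exact Submodule.subset_span ⟨J, α, h, rfl⟩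
  · exact zero_mem _

theorem projA_mem_koszulDegree {n : ℕ} {x : Koszul k K} (hx : x ∈ koszulDegree k K n) :
    (projA k K x : Koszul k K) ∈ koszulDegree k K n :=
  projA_mem_span k K hx

theorem projA_mem_koszulBidegree {s t : ℤ} {x : Koszul k K} (hx : x ∈ koszulBidegree k K s t) :
    (projA k K x : Koszul k K) ∈ koszulBidegree k K s t := by
  simp only [koszulBidegree, ← and_assoc] at hx ⊢
  exact projA_mem_span k K hx

theorem koszulD_mem_nonSqfree {x : Koszul k K} (hx : x ∈ nonSqfree k K) :
    koszulD k K x ∈ nonSqfree k K := by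
  refine (Submodule.span_le (p := (nonSqfree k K).comap (koszulD k K))).2 ?_ hx
  rintro _ ⟨J, α, ⟨i, hi⟩, rfl⟩
  rw [SetLike.mem_coe, Submodule.mem_comap, koszulD_koszulMonomial]
  refine Submodule.sum_mem _ fun j hj => Submodule.smul_mem _ _ ?_
  refine koszulMonomial_mem_nonSqfree k K ?_
  rw [defectSet_erase hj]
  exact ⟨i, mem_defectSet.2 hi⟩

/-- Together with `mul_mem_nonSqfree_right`: the complement of `A^*(K)` is an ideal. -/
theorem mul_mem_nonSqfree_left (y : Koszul k K) {x : Koszul k K} (hx : x ∈ nonSqfree k K) :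
    y * x ∈ nonSqfree k K := by
  have hy : y ∈ Submodule.span k (Set.range fun p : Finset (Fin m) × (Fin m →₀ ℕ) =>
      koszulMonomial k K p.1 p.2) := span_koszulMonomial k K ▸ Submodule.mem_top
  rw [nonSqfree] at hx
  induction hy, hx using Submodule.span_induction₂ with
  | mem_mem x y hx hy =>
    obtain ⟨⟨J, α⟩, rfl⟩ := hx
    obtain ⟨J', α', ⟨i, hi⟩, rfl⟩ := hy
    rw [koszulMonomial_mul]
    split_ifs with h
    · refine Submodule.smul_mem _ _ (koszulMonomial_mem_nonSqfree k K ⟨i, mem_defectSet.2 ?_⟩)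
      rw [Finset.mem_union, Finsupp.add_apply]
      rcases hi with hi | hi
      · exact Or.inl (by omega)
      · exact Or.inr ⟨Or.inr hi.1, by omega⟩
    · exact zero_mem _
  | zero_left y _ => rw [zero_mul]; exact zero_mem _
  | zero_right x _ => rw [mul_zero]; exact zero_mem _
  | add_left x y z _ _ _ h1 h2 => rw [add_mul]; exact add_mem h1 h2
  | add_right x y z _ _ _ h1 h2 => rw [mul_add]; exact add_mem h1 h2
  | smul_left r x y _ _ h => rw [smul_mul_assoc]; exact Submodule.smul_mem _ _ h
  | smul_right r x y _ _ h => rw [mul_smul_comm]; exact Submodule.smul_mem _ _ h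

theorem mul_mem_nonSqfree_right {x : Koszul k K} (hx : x ∈ nonSqfree k K) (y : Koszul k K) :
    x * y ∈ nonSqfree k K := by
  have hy : y ∈ Submodule.span k (Set.range fun p : Finset (Fin m) × (Fin m →₀ ℕ) =>
      koszulMonomial k K p.1 p.2) := span_koszulMonomial k K ▸ Submodule.mem_top
  rw [nonSqfree] at hx
  induction hx, hy using Submodule.span_induction₂ with
  | mem_mem x y hx hy =>
    obtain ⟨J', α', ⟨i, hi⟩, rfl⟩ := hx
    obtain ⟨⟨J, α⟩, rfl⟩ := hy
    rw [koszulMonomial_mul]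
    split_ifs with h
    · refine Submodule.smul_mem _ _ (koszulMonomial_mem_nonSqfree k K ⟨i, mem_defectSet.2 ?_⟩)
      rw [Finset.mem_union, Finsupp.add_apply]
      rcases hi with hi | hi
      · exact Or.inl (by omega)
      · exact Or.inr ⟨Or.inl hi.1, by omega⟩
    · exact zero_mem _
  | zero_left y _ => rw [zero_mul]; exact zero_mem _
  | zero_right x _ => rw [mul_zero]; exact zero_mem _
  | add_left x y z _ _ _ h1 h2 => rw [add_mul]; exact add_mem h1 h2
  | add_right x y z _ _ _ h1 h2 => rw [mul_add]; exact add_mem h1 h2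
  | smul_left r x y _ _ h => rw [smul_mul_assoc]; exact Submodule.smul_mem _ _ h
  | smul_right r x y _ _ h => rw [mul_smul_comm]; exact Submodule.smul_mem _ _ h

theorem coe_dA (a : A k K) : (dA k K a : Koszul k K) = koszulD k K a := rfl

theorem mulA_apply (a b : A k K) : mulA k K a b = projA k K ((a : Koszul k K) * b) := rfl

theorem dA_projA (x : Koszul k K) : dA k K (projA k K x) = projA k K (koszulD k K x) := by
  have h := projA_congr k K (x := koszulD k K x) (y := koszulD k K (projA k K x)) (by
    rw [← map_sub]
    exact koszulD_mem_nonSqfree k K (sub_projA_mem k K x))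
  rw [h, ← coe_dA, projA_coe]

/-- Together with `mulA_projA_right` and `dA_projA`: the projection onto `A^*(K)` is compatible with
products and differentials, so `A^*(K)` is a quotient of the Koszul algebra. -/
theorem mulA_projA_left (x : Koszul k K) (b : A k K) :
    mulA k K (projA k K x) b = projA k K (x * b) := by
  rw [mulA_apply]
  refine (projA_congr k K ?_).symm
  rw [← sub_mul]
  exact mul_mem_nonSqfree_right k K (sub_projA_mem k K x) _

theorem mulA_projA_right (a : A k K) (x : Koszul k K) :
    mulA k K a (projA k K x) = projA k K (a * x) := by
  rw [mulA_apply]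
  refine (projA_congr k K ?_).symm
  rw [← mul_sub]
  exact mul_mem_nonSqfree_left k K _ (sub_projA_mem k K x)

/-! ### The contracting homotopy of the complement -/

/-- The homotopy between the identity of `Λ[u_1, …, u_m] ⊗ k(K)` and the projection onto
`A^*(K)`. It vanishes on the monomials in `A^*(K)`; it takes any other monomial `v_i x` to `u_i x`,
where `i` is the least index such that the monomial is divisible by `v_i ^ 2` or `u_i v_i`. The
value is zero if `u_i` divides `x`. -/
def koszulHomotopy : Koszul k K →ₗ[k] Koszul k K :=
  (koszulBasis k K).constr k fun p =>
    if h : (defectSet p.1 p.2.1).Nonempty then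
      (extGen k ((defectSet p.1 p.2.1).min' h) ⊗ₜ 1) *
        koszulMonomial k K p.1 (p.2.1 - Finsupp.single ((defectSet p.1 p.2.1).min' h) 1)
    else 0

theorem koszulHomotopy_of_eq_empty {J : Finset (Fin m)} {α : Fin m →₀ ℕ}
    (h : defectSet J α = ∅) : koszulHomotopy k K (koszulMonomial k K J α) = 0 := by
  by_cases hα : α.support ∈ K.faces
  · have := koszulBasis_apply k K (J, ⟨α, hα⟩)
    rw [← this, koszulHomotopy, Module.Basis.constr_basis, dif_neg]
    simp [h]
  · rw [koszulMonomial_eq_zero k K J hα, map_zero]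

/-- The defining formula of the homotopy; it also holds for the monomials that vanish in `k(K)`,
which are not members of the basis. -/
theorem koszulHomotopy_of_isLeast {J : Finset (Fin m)} {α : Fin m →₀ ℕ} {i : Fin m}
    (hi : i ∈ defectSet J α) (hmin : ∀ j ∈ defectSet J α, i ≤ j) :
    koszulHomotopy k K (koszulMonomial k K J α) =
      (extGen k i ⊗ₜ 1) * koszulMonomial k K J (α - Finsupp.single i 1) := by
  by_cases hα : α.support ∈ K.faces
  · have := koszulBasis_apply k K (J, ⟨α, hα⟩)
    have hm : (defectSet J α).min' ⟨i, hi⟩ = i :=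
      le_antisymm (Finset.min'_le _ _ hi) (Finset.le_min' _ _ _ hmin)
    rw [← this, koszulHomotopy, Module.Basis.constr_basis, dif_pos ⟨i, hi⟩]
    simp only [hm]
  · rw [koszulMonomial_eq_zero k K J hα, map_zero]
    by_cases hJ : i ∈ J
    · rw [koszulMonomial, Algebra.TensorProduct.tmul_mul_tmul, extGen_mul_extMonomial, if_pos hJ,
        TensorProduct.zero_tmul]
    · -- here `v_i ^ 2` divides the monomial, and division by `v_i` keeps the support
      have h2 : 2 ≤ α i := (mem_defectSet.1 hi).resolve_right fun h => hJ h.1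
      have hs : (α - Finsupp.single i 1).support = α.support := by
        ext j
        by_cases hji : j = i
        · subst hji
          simp
          omega
        · simp [Finsupp.single_eq_of_ne hji]
      rw [koszulMonomial_eq_zero k K J (hs ▸ hα), mul_zero]

/-- The homotopy connects the identity with the projection onto `A^*(K)`. -/
theorem koszulD_koszulHomotopy_add (x : Koszul k K) :
    koszulD k K (koszulHomotopy k K x) + koszulHomotopy k K (koszulD k K x) =
      x - projA k K x := by
  suffices h : koszulD k K ∘ₗ koszulHomotopy k K + koszulHomotopy k K ∘ₗ koszulD k K =
      LinearMap.id - (A k K).subtype ∘ₗ projA k K from LinearMap.congr_fun h x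
  refine koszul_hom_ext k K fun J α => ?_
  simp only [LinearMap.add_apply, LinearMap.comp_apply, LinearMap.sub_apply, LinearMap.id_apply,
    Submodule.subtype_apply, projA_koszulMonomial]
  rcases (defectSet J α).eq_empty_or_nonempty with h | h
  · rw [koszulHomotopy_of_eq_empty k K h, map_zero, if_pos h, sub_self, zero_add,
      koszulD_koszulMonomial, map_sum]
    refine Finset.sum_eq_zero fun j hj => ?_
    rw [map_smul, koszulHomotopy_of_eq_empty k K ((defectSet_erase hj).trans h), smul_zero]
  · rw [if_neg h.ne_empty, sub_zero]
    obtain ⟨i, hi, hmin⟩ : ∃ i ∈ defectSet J α, ∀ j ∈ defectSet J α, i ≤ j :=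
      ⟨_, Finset.min'_mem _ h, fun j hj => Finset.min'_le _ _ hj⟩
    obtain ⟨β, rfl⟩ : ∃ β, α = β + Finsupp.single i 1 := by
      refine ⟨α - Finsupp.single i 1, (tsub_add_cancel_of_le ?_).symm⟩
      rw [Finsupp.single_le_iff]
      rcases mem_defectSet.1 hi with h | h <;> omega
    have h1 : (1 ⊗ₜ faceMonomial k K (Finsupp.single i 1)) * koszulMonomial k K J β =
        koszulMonomial k K J (β + Finsupp.single i 1) := by
      rw [koszulMonomial, Algebra.TensorProduct.tmul_mul_tmul, one_mul, faceMonomial_mul,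
        koszulMonomial, add_comm]
    -- with `x` the monomial `u_J v ^ β`: `d h (v_i x) = v_i x - u_i d x`, and
    -- `h d (v_i x) = u_i d x` as all the terms of `d (v_i x) = v_i d x` have the least defect `i`
    rw [koszulHomotopy_of_isLeast k K hi hmin, add_tsub_cancel_right, koszulD_u_mul, h1,
      koszulD_koszulMonomial, koszulD_koszulMonomial, map_sum, Finset.mul_sum, sub_add,
      sub_eq_self, sub_eq_zero]
    refine Finset.sum_congr rfl fun j hj => ?_
    rw [map_smul, koszulHomotopy_of_isLeast k K (i := i), mul_smul_comm, add_right_comm,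
      add_tsub_cancel_right]
    · rwa [defectSet_erase hj]
    · rwa [defectSet_erase hj]

theorem koszulHomotopy_mem_koszulBidegree {s t : ℤ} {x : Koszul k K}
    (hx : x ∈ koszulBidegree k K s t) :
    koszulHomotopy k K x ∈ koszulBidegree k K (s - 1) t := by
  refine (Submodule.span_le
    (p := (koszulBidegree k K (s - 1) t).comap (koszulHomotopy k K))).2 ?_ hx
  rintro _ ⟨J, α, rfl, rfl, rfl⟩
  rw [SetLike.mem_coe, Submodule.mem_comap]
  rcases (defectSet J α).eq_empty_or_nonempty with h | h
  · rw [koszulHomotopy_of_eq_empty k K h]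
    exact zero_mem _
  · obtain ⟨i, hi, hmin⟩ : ∃ i ∈ defectSet J α, ∀ j ∈ defectSet J α, i ≤ j :=
      ⟨_, Finset.min'_mem _ h, fun j hj => Finset.min'_le _ _ hj⟩
    obtain ⟨β, rfl⟩ : ∃ β, α = β + Finsupp.single i 1 := by
      refine ⟨α - Finsupp.single i 1, (tsub_add_cancel_of_le ?_).symm⟩
      rw [Finsupp.single_le_iff]
      rcases mem_defectSet.1 hi with h | h <;> omega
    rw [koszulHomotopy_of_isLeast k K hi hmin, add_tsub_cancel_right, koszulMonomial,
      Algebra.TensorProduct.tmul_mul_tmul, extGen_mul_extMonomial, one_mul]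
    split_ifs with hJ
    · rw [TensorProduct.zero_tmul]
      exact zero_mem _
    · rw [← TensorProduct.smul_tmul']
      refine Submodule.smul_mem _ _ (Submodule.subset_span ⟨insert i J, β, ?_, ?_, rfl⟩)
      · rw [Finset.card_insert_of_notMem hJ]
        push_cast
        ring
      · rw [Finset.card_insert_of_notMem hJ, map_add, Finsupp.degree_single]
        push_cast
        ring

end Projection

/-! ### Coordinates of a product of cubes -/

section Coordinates

variable {m : ℕ} {n : Fin m → ℕ}

/-- The numbering `finSigmaFinEquiv` runs through the blocks `Fin (n i)` one after the other. -/
theorem finSigmaFinEquiv_val (i : Fin m) (j : Fin (n i)) :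
    (finSigmaFinEquiv ⟨i, j⟩ : ℕ) = ∑ l ∈ Finset.Iio i, n l + j := by
  rw [finSigmaFinEquiv_apply]
  congr 1
  refine Finset.sum_bij (fun l _ => Fin.castLE i.2.le l) ?_ ?_ ?_ ?_
  · exact fun l _ => Finset.mem_Iio.2 l.2
  · exact fun l _ l' _ h => Fin.castLE_injective _ h
  · exact fun l hl => ⟨⟨l, show l < i from Finset.mem_Iio.1 hl⟩, Finset.mem_univ _, rfl⟩
  · exact fun _ _ => rfl

theorem finSigmaFinEquiv_lt_of_fst_lt {i i' : Fin m} (h : i < i') (j : Fin (n i))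
    (j' : Fin (n i')) : finSigmaFinEquiv ⟨i, j⟩ < finSigmaFinEquiv ⟨i', j'⟩ := by
  rw [Fin.lt_def, finSigmaFinEquiv_val, finSigmaFinEquiv_val]
  have hs : insert i (Finset.Iio i) ⊆ Finset.Iio i' := by
    intro l hl
    rcases Finset.mem_insert.1 hl with rfl | hl
    · exact Finset.mem_Iio.2 h
    · exact Finset.mem_Iio.2 ((Finset.mem_Iio.1 hl).trans h)
  have := Finset.sum_le_sum_of_subset (f := n) hs
  rw [Finset.sum_insert (by simp)] at this
  omega

theorem finSigmaFinEquiv_lt_of_snd_lt {i : Fin m} {j j' : Fin (n i)} (h : j < j') :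
    finSigmaFinEquiv ⟨i, j⟩ < finSigmaFinEquiv ⟨i, j'⟩ := by
  rw [Fin.lt_def, finSigmaFinEquiv_val, finSigmaFinEquiv_val]
  exact Nat.add_lt_add_left h _

theorem finSigmaFinEquiv_lt_iff {i i' : Fin m} (h : i ≠ i') (j : Fin (n i)) (j' : Fin (n i')) :
    finSigmaFinEquiv ⟨i, j⟩ < finSigmaFinEquiv ⟨i', j'⟩ ↔ i < i' := by
  refine ⟨fun hlt => ?_, fun hlt => finSigmaFinEquiv_lt_of_fst_lt hlt j j'⟩
  exact (lt_or_gt_of_ne h).resolve_right fun hgt =>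
    lt_asymm hlt (finSigmaFinEquiv_lt_of_fst_lt hgt j' j)

end Coordinates

/-! ### Faces of singular cubes -/

section Faces

variable {X : Type*} [TopologicalSpace X]

/-- Recognition of a face from an increasing enumeration `g` of its free coordinates. -/
theorem Cube.face_eq_of_strictMono (c : Cube X) {n : ℕ} (H : Finset (Fin c.1)) (e : unitInterval)
    (g : Fin n → Fin c.1) (hg : StrictMono g) (hH : ∀ j, j ∈ H ↔ ∃ l, g l = j)
    (f : C(Fin n → unitInterval, X))
    (hf : ∀ x : Fin c.1 → unitInterval, (∀ j, j ∉ H → x j = e) → f (x ∘ g) = c.2 x) :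
    c.face H e = ⟨n, f⟩ := by
  have hc : H.card = n := by
    have : H = Finset.univ.image g := by
      ext j
      simp [hH]
    rw [this, Finset.card_image_of_injective _ hg.injective, Finset.card_univ, Fintype.card_fin]
  subst hc
  have hg' : ∀ l, g l = H.orderEmbOfFin rfl l := fun l =>
    congrFun (Finset.orderEmbOfFin_unique rfl (fun l => (hH _).2 ⟨l, rfl⟩) hg) l
  refine Sigma.ext rfl (heq_of_eq (ContinuousMap.ext fun y => ?_))
  refine (hf (fun j =>
    if h : j ∈ H then y ((H.orderIsoOfFin rfl).symm ⟨j, h⟩) else e) ?_).symm.trans ?_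
  · intro j hj
    rw [dif_neg hj]
  · refine congrArg f (funext fun l => ?_)
    have hl : g l ∈ H := (hH _).2 ⟨l, rfl⟩
    rw [Function.comp_apply, dif_pos hl]
    refine congrArg y ?_
    exact (OrderIso.symm_apply_eq _).2 (Subtype.ext (hg' l))

/-- A face is degenerate if the cube does not depend on one of the free coordinates as long as the
other ones keep their fixed value. -/
theorem Cube.face_degenerate (c : Cube X) (H : Finset (Fin c.1)) (e : unitInterval)
    {i : Fin c.1} (hi : i ∈ H)
    (h : ∀ x y : Fin c.1 → unitInterval, (∀ j, j ∉ H → x j = e) → (∀ j, j ∉ H → y j = e) →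
      (∀ j, j ≠ i → x j = y j) → c.2 x = c.2 y) : (c.face H e).Degenerate := by
  refine ⟨(H.orderIsoOfFin rfl).symm ⟨i, hi⟩, fun x y hxy => h _ _ ?_ ?_ ?_⟩
  · exact fun j hj => dif_neg hj
  · exact fun j hj => dif_neg hj
  · intro j hj
    simp only [ContinuousMap.coe_mk]
    split_ifs with hjH
    · refine hxy _ fun h' => hj ?_
      exact congrArg Subtype.val ((H.orderIsoOfFin rfl).symm.injective h')
    · rfl

end Faces

/-! ### Faces of the characteristic maps of the cells of the disk -/

namespace CellType

/-- The face of the characteristic map of the cell `t` of `D²`, in which the coordinates in `S`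
run freely and the others are equal to `e`, is the characteristic map of the cell `t'`. -/
def IsFace (t t' : CellType) (S : Set (Fin t.dim)) (e : unitInterval) : Prop :=
  ∃ g : Fin t'.dim → Fin t.dim, StrictMono g ∧ (∀ j, j ∈ S ↔ ∃ l, g l = j) ∧
    ∀ x : Fin t.dim → unitInterval, (∀ j, j ∉ S → x j = e) → t'.charFun (x ∘ g) = t.charFun x

/-- The face of the characteristic map of the cell `t` of `D²`, in which the coordinates in `S`
run freely and the others are equal to `e`, does not depend on the free coordinate `i`. -/
def IsDegenerateFace (t : CellType) (S : Set (Fin t.dim)) (e : unitInterval) (i : Fin t.dim) :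
    Prop :=
  i ∈ S ∧ ∀ x y : Fin t.dim → unitInterval, (∀ j, j ∉ S → x j = e) → (∀ j, j ∉ S → y j = e) →
    (∀ j, j ≠ i → x j = y j) → t.charFun x = t.charFun y

theorem isFace_self (t : CellType) {S : Set (Fin t.dim)} (e : unitInterval) (hS : ∀ j, j ∈ S) :
    t.IsFace t S e :=
  ⟨id, strictMono_id, fun j => by simp [hS], fun _ _ => rfl⟩

/-- The vertices `(0, …, 0)` and `(1, …, 1)` are sent to the base point `1`. -/
theorem charFun_const (t : CellType) {e : unitInterval} (he : e = 0 ∨ e = 1)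
    (x : Fin t.dim → unitInterval) (hx : ∀ j, x j = e) : t.charFun x = 1 := by
  rcases he with rfl | rfl <;> cases t
  · rfl
  · simp [charFun, hx (0 : Fin 1)]
  · simp [charFun, hx (0 : Fin 2)]
  · rfl
  · simp [charFun, hx (0 : Fin 1)]
  · simp [charFun, hx (0 : Fin 2), hx (1 : Fin 2)]

theorem isFace_one (t : CellType) {S : Set (Fin t.dim)} {e : unitInterval} (he : e = 0 ∨ e = 1)
    (hS : ∀ j, j ∉ S) : t.IsFace one S e := by
  refine ⟨Fin.elim0, fun j => Fin.elim0 j, fun j => ?_, fun x hx => ?_⟩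
  · exact ⟨fun h => absurd h (hS j), fun ⟨l, _⟩ => Fin.elim0 l⟩
  · exact (charFun_const t he x fun j => hx j (hS j)).symm

/-- The side `s = 1` of the square that is the domain of the characteristic map of `D`
parametrizes the circle. -/
theorem isFace_D_T {S : Set (Fin D.dim)} (h0 : (0 : Fin 2) ∉ S) (h1 : (1 : Fin 2) ∈ S) :
    D.IsFace T S 1 := by
  refine ⟨fun _ => (1 : Fin 2), Subsingleton.strictMono (α := Fin 1) _, fun j => ?_,
    fun x hx => ?_⟩
  · match j with
    | (0 : Fin 2) => simpa using h0
    | (1 : Fin 2) => simpa using h1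
  · simp [charFun, hx _ h0]

/-- The side `s = 0` of the square is collapsed to the point `1`. -/
theorem isDegenerateFace_D_zero {S : Set (Fin D.dim)} (h0 : (0 : Fin 2) ∉ S)
    (h1 : (1 : Fin 2) ∈ S) : D.IsDegenerateFace S 0 (1 : Fin 2) :=
  ⟨h1, fun x y hx hy _ => by simp [charFun, hx _ h0, hy _ h0]⟩

/-- The sides `t = 0` and `t = 1` of the square are collapsed to the point `1`. -/
theorem isDegenerateFace_D_one {S : Set (Fin D.dim)} {e : unitInterval} (he : e = 0 ∨ e = 1)
    (h0 : (0 : Fin 2) ∈ S) (h1 : (1 : Fin 2) ∉ S) : D.IsDegenerateFace S e (0 : Fin 2) := by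
  refine ⟨h0, fun x y hx hy _ => ?_⟩
  rcases he with rfl | rfl <;> simp [charFun, hx _ h1, hy _ h1]

theorem exists_isFace_or_isDegenerateFace (t : CellType) (S : Set (Fin t.dim)) {e : unitInterval}
    (he : e = 0 ∨ e = 1) :
    (∃ t', (t' = D → t = D) ∧ t.IsFace t' S e) ∨ ∃ i, t.IsDegenerateFace S e i := by
  by_cases hu : ∀ j, j ∈ S
  · exact Or.inl ⟨t, id, isFace_self t e hu⟩
  by_cases hn : ∀ j, j ∉ S
  · exact Or.inl ⟨one, nofun, isFace_one t he hn⟩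
  cases t
  · exact absurd (fun j => Fin.elim0 j) hu
  · push Not at hn hu
    obtain ⟨i, hi⟩ := hn
    obtain ⟨j, hj⟩ := hu
    exact absurd (Subsingleton.elim (α := Fin 1) i j ▸ hi) hj
  · by_cases h0 : (0 : Fin 2) ∈ S <;> by_cases h1 : (1 : Fin 2) ∈ S
    · exact absurd (Fin.forall_fin_two.2 ⟨h0, h1⟩) hu
    · exact Or.inr ⟨_, isDegenerateFace_D_one he h0 h1⟩
    · rcases he with rfl | rfl
      · exact Or.inr ⟨_, isDegenerateFace_D_zero h0 h1⟩
      · exact Or.inl ⟨T, nofun, isFace_D_T h0 h1⟩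
    · exact absurd (Fin.forall_fin_two.2 ⟨h0, h1⟩) hn

end CellType

/-! ### Faces of the cells of the moment-angle complex -/

section Cells

variable {m : ℕ} {K : SimplicialComplexOn m}

/-- The numbering of the coordinates of the characteristic map of a cell, in the order of the
factors. -/
def Cell.coordEquiv (w : Cell K) : (Σ i, Fin (w.1 i).dim) ≃ Fin w.cube.1 := finSigmaFinEquiv

/-- The number, among all the coordinates of the characteristic map of a cell, of a coordinate of
one of the factors. -/
def Cell.coord (w : Cell K) (i : Fin m) (j : Fin (w.1 i).dim) : Fin w.cube.1 :=
  w.coordEquiv ⟨i, j⟩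

theorem Cell.coord_surjective (w : Cell K) (c : Fin w.cube.1) : ∃ i j, w.coord i j = c := by
  obtain ⟨⟨i, j⟩, rfl⟩ := w.coordEquiv.surjective c
  exact ⟨i, j, rfl⟩

theorem Cell.coordEquiv_symm_coord (w : Cell K) (i : Fin m) (j : Fin (w.1 i).dim) :
    w.coordEquiv.symm (w.coord i j) = ⟨i, j⟩ :=
  w.coordEquiv.symm_apply_apply _

theorem Cell.coord_val (w : Cell K) (i : Fin m) (j : Fin (w.1 i).dim) :
    (w.coord i j : ℕ) = ∑ l ∈ Finset.Iio i, (w.1 l).dim + j :=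
  finSigmaFinEquiv_val (n := fun i => (w.1 i).dim) i j

theorem Cell.coord_lt_iff (w : Cell K) {i i' : Fin m} (h : i ≠ i') (j : Fin (w.1 i).dim)
    (j' : Fin (w.1 i').dim) : w.coord i j < w.coord i' j' ↔ i < i' :=
  finSigmaFinEquiv_lt_iff (n := fun i => (w.1 i).dim) h j j'

theorem Cell.coord_strictMono (w : Cell K) (i : Fin m) : StrictMono (w.coord i) :=
  fun _ _ h => finSigmaFinEquiv_lt_of_snd_lt (n := fun i => (w.1 i).dim) h

theorem Cell.cube_apply (w : Cell K) (x : Fin w.cube.1 → unitInterval) (i : Fin m) :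
    (w.cube.2 x : Fin m → ℂ) i = (w.1 i).charFun fun j => x (w.coord i j) := rfl

theorem Cell.coord_inj {w : Cell K} {i i' : Fin m} {j : Fin (w.1 i).dim} {j' : Fin (w.1 i').dim}
    (h : w.coord i j = w.coord i' j') : (⟨i, j⟩ : Σ i, Fin (w.1 i).dim) = ⟨i', j'⟩ :=
  w.coordEquiv.injective h

/-- A face of the characteristic cube of a cell can be computed factor by factor. -/
theorem Cell.face_eq (w w' : Cell K) (H : Finset (Fin w.cube.1)) (e : unitInterval)
    (h : ∀ i, (w.1 i).IsFace (w'.1 i) {j | w.coord i j ∈ H} e) : w.cube.face H e = w'.cube := by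
  choose g hg hS hf using h
  obtain ⟨G, hG⟩ : ∃ G : Fin w'.cube.1 → Fin w.cube.1,
      ∀ i j, G (w'.coord i j) = w.coord i (g i j) :=
    ⟨fun l => w.coord (w'.coordEquiv.symm l).1 (g _ (w'.coordEquiv.symm l).2), fun i j =>
      congrArg (fun p : Σ i, Fin (w'.1 i).dim => w.coord p.1 (g p.1 p.2))
        (w'.coordEquiv_symm_coord i j)⟩
  refine Cube.face_eq_of_strictMono w.cube H e G ?_ ?_ w'.cube.2 ?_
  · intro l l' hl
    obtain ⟨i, j, rfl⟩ := w'.coord_surjective l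
    obtain ⟨i', j', rfl⟩ := w'.coord_surjective l'
    rw [hG, hG]
    by_cases hi : i = i'
    · subst hi
      exact w.coord_strictMono i (hg i ((w'.coord_strictMono i).lt_iff_lt.1 hl))
    · exact (w.coord_lt_iff hi _ _).2 ((w'.coord_lt_iff hi j j').1 hl)
  · intro c
    obtain ⟨i, j, rfl⟩ := w.coord_surjective c
    have := hS i j
    rw [Set.mem_ofPred_eq] at this
    rw [this]
    constructor
    · rintro ⟨l, rfl⟩
      exact ⟨w'.coord i l, hG i l⟩
    · rintro ⟨l, hl⟩
      obtain ⟨i', l, rfl⟩ := w'.coord_surjective l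
      rw [hG] at hl
      have := Cell.coord_inj hl
      rw [Sigma.mk.injEq] at this
      obtain ⟨rfl, h⟩ := this
      exact ⟨l, eq_of_heq h⟩
  · intro x hx
    refine Subtype.ext (funext fun i => ?_)
    rw [Cell.cube_apply, Cell.cube_apply,
      ← hf i (fun j => x (w.coord i j)) fun j hj => hx _ hj]
    exact congrArg _ (funext fun l => congrArg x (hG i l))

/-- A face of the characteristic cube of a cell is degenerate if it is so in one factor. -/
theorem Cell.face_degenerate (w : Cell K) (H : Finset (Fin w.cube.1)) (e : unitInterval)
    {i : Fin m} {j : Fin (w.1 i).dim}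
    (h : (w.1 i).IsDegenerateFace {j | w.coord i j ∈ H} e j) : (w.cube.face H e).Degenerate := by
  refine Cube.face_degenerate w.cube H e h.1 fun x y hx hy hxy => ?_
  refine Subtype.ext (funext fun i' => ?_)
  rw [Cell.cube_apply, Cell.cube_apply]
  by_cases hi : i' = i
  · subst hi
    refine h.2 _ _ (fun l hl => hx _ hl) (fun l hl => hy _ hl) fun l hl => hxy _ fun h' => hl ?_
    exact eq_of_heq (Sigma.mk.inj (Cell.coord_inj h')).2
  · refine congrArg _ (funext fun l => hxy _ fun h' => hi ?_)
    exact (Sigma.mk.inj (Cell.coord_inj h')).1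

/-- A cell with factors of type `D` only where a given cell has such factors. -/
def Cell.replace (w : Cell K) (v : Fin m → CellType) (h : ∀ i, v i = .D → w.1 i = .D) : Cell K :=
  ⟨v, K.down_closed w.2 fun i hi => by
    simp only [letters, Finset.mem_filter, Finset.mem_univ, true_and] at hi ⊢
    exact h i hi⟩

/-- The faces of a cell that are relevant to the coboundary and to the product are degenerate or
cells. -/
theorem Cell.exists_face_eq_or_degenerate (w : Cell K) (H : Finset (Fin w.cube.1))
    {e : unitInterval} (he : e = 0 ∨ e = 1) :
    (∃ w' : Cell K, w.cube.face H e = w'.cube) ∨ (w.cube.face H e).Degenerate := by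
  by_cases h : ∃ i j, (w.1 i).IsDegenerateFace {j | w.coord i j ∈ H} e j
  · obtain ⟨i, j, hj⟩ := h
    exact Or.inr (w.face_degenerate H e hj)
  · choose v hv hf using fun i => ((w.1 i).exists_isFace_or_isDegenerateFace
      {j | w.coord i j ∈ H} he).resolve_right fun h' => h ⟨i, h'⟩
    exact Or.inl ⟨w.replace v hv, w.face_eq _ H e hf⟩

/-- A cell is the image of the interior of its characteristic cube, and different cells are
disjoint. -/
theorem Cell.cube_injective : Function.Injective (Cell.cube (K := K)) := by
  intro w w' h
  have hs : ∀ c c' : Cube (momentAngle K), c = c' →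
      {z : Fin m → ℂ | ∃ x, (∀ j, 0 < x j ∧ x j < 1) ∧ (c.2 x : Fin m → ℂ) = z} =
        {z | ∃ x, (∀ j, 0 < x j ∧ x j < 1) ∧ (c'.2 x : Fin m → ℂ) = z} := by
    rintro c _ rfl
    rfl
  have ho : ∀ w : Cell K, {z : Fin m → ℂ | ∃ x, (∀ j, 0 < x j ∧ x j < 1) ∧
      (w.cube.2 x : Fin m → ℂ) = z} = w.openCell := fun w => w.bijOn_charFun.image_eq
  have he := hs _ _ h
  rw [ho, ho] at he
  have hx : w.charFun (fun _ => ⟨1 / 2, by norm_num, by norm_num⟩) ∈ w.openCell := by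
    refine w.bijOn_charFun.mapsTo fun j => ⟨?_, ?_⟩
    · exact Subtype.mk_lt_mk.2 (by norm_num)
    · exact Subtype.mk_lt_mk.2 (by norm_num)
  exact ((mem_momentAngle_iff _).1 (w.charFun_mem _)).unique hx (he ▸ hx)

/-- The characteristic map is injective on the interior of the cube. -/
theorem Cell.cube_not_degenerate (w : Cell K) : ¬ w.cube.Degenerate := by
  suffices h : ∀ i : Fin w.dim, ¬ ∀ x y : Fin w.dim → unitInterval,
      (∀ j, j ≠ i → x j = y j) → w.charFun x = w.charFun y by
    rintro ⟨i, hi⟩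
    exact h i fun x y hxy => congrArg Subtype.val (hi x y hxy)
  intro i hi
  -- moving the coordinate `i` inside the interior of the cube moves the image point
  obtain ⟨a, ha0, ha1⟩ : ∃ a : unitInterval, 0 < a ∧ a < 1 := exists_between zero_lt_one
  obtain ⟨b, hb0, hb1⟩ : ∃ b : unitInterval, 0 < b ∧ b < a := exists_between ha0
  have h1 : ∀ j, 0 < Function.update (fun _ : Fin w.dim => a) i b j ∧
      Function.update (fun _ : Fin w.dim => a) i b j < 1 := by
    intro j
    by_cases hj : j = i
    · subst hj
      simp [hb0, hb1.trans ha1]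
    · simp [Function.update_of_ne hj, ha0, ha1]
  have h2 := w.bijOn_charFun.injOn (fun _ => ⟨ha0, ha1⟩) h1
    (hi (fun _ => a) (Function.update (fun _ => a) i b) fun j hj => by
      rw [Function.update_of_ne hj])
  have h3 := congrFun h2 i
  rw [Function.update_self] at h3
  exact hb1.ne' h3

variable (k : Type*) [CommRing k]

theorem cellExtend_cube (f : CellCochain K k) (w : Cell K) : cellExtend K k f w.cube = f w :=
  Cell.cube_injective.extend_apply _ _ _

theorem cellExtend_degenerate (f : CellCochain K k) {c : Cube (momentAngle K)}
    (hc : c.Degenerate) : cellExtend K k f c = 0 :=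
  Function.extend_apply' _ _ _ fun ⟨w, hw⟩ => w.cube_not_degenerate (hw ▸ hc)

/-- A normalized cochain and the extension by zero of its restriction to the cells agree on the
faces of the cells. -/
theorem cellExtend_cellRestrict_face {F : Cube (momentAngle K) → k} (hF : IsNormalized F)
    (w : Cell K) (H : Finset (Fin w.cube.1)) {e : unitInterval} (he : e = 0 ∨ e = 1) :
    cellExtend K k (cellRestrict K k F) (w.cube.face H e) = F (w.cube.face H e) := by
  rcases w.exists_face_eq_or_degenerate H he with ⟨w', hw'⟩ | hd
  · rw [hw', cellExtend_cube]
    rfl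
  · rw [cellExtend_degenerate k _ hd, hF _ hd]

theorem cellD_apply (f : CellCochain K k) (w : Cell K) :
    cellD K k f w = ∑ c : Fin w.cube.1, (-1) ^ (c : ℕ) *
      (cellExtend K k f (w.cube.face {c}ᶜ 1) - cellExtend K k f (w.cube.face {c}ᶜ 0)) := rfl

theorem cellMul_apply (f g : CellCochain K k) (w : Cell K) :
    cellMul K k f g w = ∑ H : Finset (Fin w.cube.1), shuffleSign k H *
      (cellExtend K k f (w.cube.face H 0) * cellExtend K k g (w.cube.face Hᶜ 1)) := rfl

theorem cellRestrict_cubeCoboundary {F : Cube (momentAngle K) → k} (hF : IsNormalized F) :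
    cellRestrict K k (cubeCoboundary k F) = cellD K k (cellRestrict K k F) := by
  funext w
  rw [cellD_apply]
  simp only [cellExtend_cellRestrict_face k hF w _ (Or.inl rfl),
    cellExtend_cellRestrict_face k hF w _ (Or.inr rfl)]
  rfl

theorem cellRestrict_cubeCup {F G : Cube (momentAngle K) → k} (hF : IsNormalized F)
    (hG : IsNormalized G) :
    cellRestrict K k (cubeCup k F G) =
      cellMul K k (cellRestrict K k F) (cellRestrict K k G) := by
  funext w
  rw [cellMul_apply]
  simp only [cellExtend_cellRestrict_face k hF w _ (Or.inl rfl),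
    cellExtend_cellRestrict_face k hG w _ (Or.inr rfl)]
  rfl

end Cells

section CellularFormulas

variable {m : ℕ} {K : SimplicialComplexOn m} (k : Type*) [CommRing k]

/-! ### The cellular coboundary of a cochain -/

/-- The cell obtained by putting the circle `T` at the place `i`. -/
def Cell.circleAt (w : Cell K) (i : Fin m) : Cell K :=
  w.replace (Function.update w.1 i .T) fun l hl => by
    by_cases h : l = i
    · subst h
      simp at hl
    · rwa [Function.update_of_ne h] at hl

theorem Cell.circleAt_apply (w : Cell K) (i l : Fin m) :
    (w.circleAt i).1 l = if l = i then .T else w.1 l :=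
  Function.update_apply _ _ _ _

theorem Cell.sum_coord {M : Type*} [AddCommMonoid M] (w : Cell K) (F : Fin w.cube.1 → M) :
    ∑ c, F c = ∑ i, ∑ j, F (w.coord i j) := by
  rw [← w.coordEquiv.sum_comp, Fintype.sum_sigma]
  rfl

theorem Cell.coord_mem_compl_singleton (w : Cell K) {i i' : Fin m} (h : i' ≠ i)
    (j : Fin (w.1 i).dim) (j' : Fin (w.1 i').dim) :
    w.coord i' j' ∈ ({w.coord i j}ᶜ : Finset (Fin w.cube.1)) := by
  rw [Finset.mem_compl, Finset.mem_singleton]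
  exact fun h' => h (Sigma.mk.inj (Cell.coord_inj h')).1

theorem Cell.coord_mem_compl_singleton_iff (w : Cell K) (i : Fin m) (j j' : Fin (w.1 i).dim) :
    w.coord i j' ∈ ({w.coord i j}ᶜ : Finset (Fin w.cube.1)) ↔ j' ≠ j := by
  rw [Finset.mem_compl, Finset.mem_singleton, (w.coord_strictMono i).injective.eq_iff]

/-- The circle is closed: both faces of a cell that fix the coordinate of a factor `T` replace this
factor by the point `1`. -/
theorem Cell.face_one_eq_face_zero (w : Cell K) {i : Fin m} (hi : w.1 i ≠ .D)
    (j : Fin (w.1 i).dim) :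
    w.cube.face {w.coord i j}ᶜ 1 = w.cube.face {w.coord i j}ᶜ 0 := by
  have hv : ∀ l, Function.update w.1 i .one l = .D → w.1 l = .D := by
    intro l hl
    by_cases h : l = i
    · subst h
      simp at hl
    · rwa [Function.update_of_ne h] at hl
  have hs : ∀ j' : Fin (w.1 i).dim, j' = j := by
    revert j
    cases h : w.1 i
    · exact fun j => Fin.elim0 j
    · exact fun j j' => Subsingleton.elim (α := Fin 1) j' j
    · exact absurd h hi
  have h : ∀ e : unitInterval, e = 0 ∨ e = 1 →
      w.cube.face {w.coord i j}ᶜ e = (w.replace _ hv).cube := by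
    intro e he
    refine w.face_eq _ _ e fun i' => ?_
    change (w.1 i').IsFace (Function.update w.1 i .one i') _ e
    by_cases h : i' = i
    · subst h
      rw [Function.update_self]
      refine CellType.isFace_one _ he fun j' hj' => ?_
      exact (w.coord_mem_compl_singleton_iff _ _ _).1 hj' (hs j')
    · rw [Function.update_of_ne h]
      exact CellType.isFace_self _ e fun j' => w.coord_mem_compl_singleton h j j'
  rw [h 1 (Or.inr rfl), h 0 (Or.inl rfl)]

theorem CellType.two_le_dim {t : CellType} (ht : t = .D) : 2 ≤ t.dim := by
  subst ht
  exact le_rfl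

theorem CellType.sum_fin_dim {M : Type*} [AddCommMonoid M] {t : CellType} (ht : t = .D)
    (F : Fin t.dim → M) :
    ∑ j, F j = F ⟨0, Nat.zero_lt_two.trans_le (two_le_dim ht)⟩ + F ⟨1, two_le_dim ht⟩ := by
  subst ht
  exact Fin.sum_univ_two F

/-- The side `s = 1` of a factor `D` gives the cell with the boundary circle at its place. -/
theorem Cell.face_circleAt (w : Cell K) {i : Fin m} (hi : w.1 i = .D)
    {j : Fin (w.1 i).dim} (hj : (j : ℕ) = 0) :
    w.cube.face {w.coord i j}ᶜ 1 = (w.circleAt i).cube := by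
  refine w.face_eq _ _ 1 fun i' => ?_
  change (w.1 i').IsFace (Function.update w.1 i .T i') _ 1
  by_cases h : i' = i
  · subst h
    rw [Function.update_self]
    have hS : ∀ j', j' ∈ {j' | w.coord i' j' ∈ ({w.coord i' j}ᶜ : Finset (Fin w.cube.1))} ↔
        j' ≠ j := fun j' => w.coord_mem_compl_singleton_iff i' j j'
    generalize {j' | w.coord i' j' ∈ ({w.coord i' j}ᶜ : Finset (Fin w.cube.1))} = S at hS
    revert j S
    rw [hi]
    rintro j hj S hS
    obtain rfl : j = (0 : Fin 2) := Fin.ext hj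
    exact CellType.isFace_D_T (by simp [hS]) ((hS _).2 (by decide))
  · rw [Function.update_of_ne h]
    exact CellType.isFace_self _ 1 fun j' => w.coord_mem_compl_singleton h j j'

/-- The side `s = 0` of a factor `D` is collapsed to a point. -/
theorem Cell.face_degenerate_of_fst (w : Cell K) {i : Fin m} (hi : w.1 i = .D)
    {j : Fin (w.1 i).dim} (hj : (j : ℕ) = 0) : (w.cube.face {w.coord i j}ᶜ 0).Degenerate := by
  suffices h : ∃ l, (w.1 i).IsDegenerateFace
      {j' | w.coord i j' ∈ ({w.coord i j}ᶜ : Finset (Fin w.cube.1))} 0 l by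
    obtain ⟨l, hl⟩ := h
    exact w.face_degenerate _ _ hl
  have hS : ∀ j', j' ∈ {j' | w.coord i j' ∈ ({w.coord i j}ᶜ : Finset (Fin w.cube.1))} ↔
      j' ≠ j := fun j' => w.coord_mem_compl_singleton_iff i j j'
  generalize {j' | w.coord i j' ∈ ({w.coord i j}ᶜ : Finset (Fin w.cube.1))} = S at hS
  revert j S
  rw [hi]
  rintro j hj S hS
  obtain rfl : j = (0 : Fin 2) := Fin.ext hj
  exact ⟨_, CellType.isDegenerateFace_D_zero (by simp [hS]) ((hS _).2 (by decide))⟩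

/-- The sides `t = 0` and `t = 1` of a factor `D` are collapsed to a point. -/
theorem Cell.face_degenerate_of_snd (w : Cell K) {i : Fin m} (hi : w.1 i = .D)
    {j : Fin (w.1 i).dim} (hj : (j : ℕ) = 1) {e : unitInterval} (he : e = 0 ∨ e = 1) :
    (w.cube.face {w.coord i j}ᶜ e).Degenerate := by
  suffices h : ∃ l, (w.1 i).IsDegenerateFace
      {j' | w.coord i j' ∈ ({w.coord i j}ᶜ : Finset (Fin w.cube.1))} e l by
    obtain ⟨l, hl⟩ := h
    exact w.face_degenerate _ _ hl
  have hS : ∀ j', j' ∈ {j' | w.coord i j' ∈ ({w.coord i j}ᶜ : Finset (Fin w.cube.1))} ↔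
      j' ≠ j := fun j' => w.coord_mem_compl_singleton_iff i j j'
  generalize {j' | w.coord i j' ∈ ({w.coord i j}ᶜ : Finset (Fin w.cube.1))} = S at hS
  revert j S
  rw [hi]
  rintro j hj S hS
  obtain rfl : j = (1 : Fin 2) := Fin.ext hj
  exact ⟨_, CellType.isDegenerateFace_D_one he ((hS _).2 (by decide)) (by simp [hS])⟩

/-- The disks have even dimension, so only the circles contribute to the sign. -/
theorem Cell.neg_one_pow_sum_dim (w : Cell K) (s : Finset (Fin m)) :
    (-1 : k) ^ (∑ l ∈ s, (w.1 l).dim) = (-1) ^ (s.filter fun l => w.1 l = .T).card := by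
  rw [← Finset.prod_pow_eq_pow_sum, ← Finset.prod_const, Finset.prod_filter]
  refine Finset.prod_congr rfl fun l _ => ?_
  cases w.1 l <;> simp [CellType.dim]

/-- The cellular coboundary: the boundary of a cell is a sum of cells, in each of which a disk
`D` is replaced by its boundary circle `T`. -/
theorem cellD_eq_sum (f : CellCochain K k) (w : Cell K) :
    cellD K k f w = ∑ i, if w.1 i = .D then
      (-1) ^ ((Finset.Iio i).filter fun l => w.1 l = .T).card * f (w.circleAt i) else 0 := by
  rw [cellD_apply, Cell.sum_coord]
  refine Finset.sum_congr rfl fun i _ => ?_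
  split_ifs with hi
  · rw [CellType.sum_fin_dim hi, w.face_circleAt hi rfl, cellExtend_cube,
      cellExtend_degenerate k f (w.face_degenerate_of_fst hi rfl),
      cellExtend_degenerate k f (w.face_degenerate_of_snd hi rfl (Or.inl rfl)),
      cellExtend_degenerate k f (w.face_degenerate_of_snd hi rfl (Or.inr rfl)),
      Cell.coord_val, ← w.neg_one_pow_sum_dim k]
    simp
  · refine Finset.sum_eq_zero fun j _ => ?_
    rw [w.face_one_eq_face_zero hi, sub_self, mul_zero]

/-! ### The product of cellular cochains -/

/-- The face of a cell in which the factors outside `P` are replaced by the point `1`. -/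
def Cell.restrict (w : Cell K) (P : Finset (Fin m)) : Cell K :=
  w.replace (fun i => if i ∈ P then w.1 i else .one) fun i hi => by
    split_ifs at hi
    exact hi

theorem Cell.restrict_apply (w : Cell K) (P : Finset (Fin m)) (i : Fin m) :
    (w.restrict P).1 i = if i ∈ P then w.1 i else .one := rfl

/-- The set of the coordinates of the factors in `P`. -/
def Cell.coords (w : Cell K) (P : Finset (Fin m)) : Finset (Fin w.cube.1) :=
  Finset.univ.filter fun c => (w.coordEquiv.symm c).1 ∈ P

theorem Cell.coord_mem_coords {w : Cell K} {P : Finset (Fin m)} {i : Fin m}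
    {j : Fin (w.1 i).dim} : w.coord i j ∈ w.coords P ↔ i ∈ P := by
  rw [Cell.coords, Finset.mem_filter, Cell.coordEquiv_symm_coord]
  simp

theorem Cell.compl_coords (w : Cell K) (P : Finset (Fin m)) : (w.coords P)ᶜ = w.coords Pᶜ := by
  ext c
  obtain ⟨i, j, rfl⟩ := w.coord_surjective c
  rw [Finset.mem_compl, coord_mem_coords, coord_mem_coords, Finset.mem_compl]

theorem Cell.face_coords (w : Cell K) (P : Finset (Fin m)) {e : unitInterval}
    (he : e = 0 ∨ e = 1) : w.cube.face (w.coords P) e = (w.restrict P).cube := by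
  refine w.face_eq _ _ e fun i => ?_
  rw [Cell.restrict_apply]
  split_ifs with hi
  · exact CellType.isFace_self _ e fun j => Cell.coord_mem_coords.2 hi
  · exact CellType.isFace_one _ he fun j hj => hi (Cell.coord_mem_coords.1 hj)

/-- The indices of the factors of positive dimension. -/
def Cell.support (w : Cell K) : Finset (Fin m) := Finset.univ.filter fun i => w.1 i ≠ .one

theorem Cell.mem_support {w : Cell K} {i : Fin m} : i ∈ w.support ↔ w.1 i ≠ .one := by
  simp [Cell.support]

/-- A point `1` has no coordinates, so only sets of factors of positive dimension are determined by
their coordinates. -/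
theorem Cell.coords_injOn (w : Cell K) :
    Set.InjOn w.coords (w.support.powerset : Set (Finset (Fin m))) := by
  have key : ∀ P Q, P ⊆ w.support → w.coords P = w.coords Q → P ⊆ Q := by
    intro P Q hP h i hi
    have h0 : 0 < (w.1 i).dim := by
      have := Cell.mem_support.1 (hP hi)
      revert this
      cases w.1 i <;> simp [CellType.dim]
    exact Cell.coord_mem_coords.1 (h ▸ Cell.coord_mem_coords (j := ⟨0, h0⟩).2 hi)
  intro P hP Q hQ h
  rw [Finset.mem_coe, Finset.mem_powerset] at hP hQ
  exact (key P Q hP h).antisymm (key Q P hQ h.symm)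

theorem CellType.isDegenerateFace_zero (t : CellType) (S : Set (Fin t.dim))
    (hu : ∃ j, j ∉ S) (hn : ∃ j, j ∈ S) : ∃ i, t.IsDegenerateFace S 0 i := by
  obtain ⟨j, hj⟩ := hu
  obtain ⟨i, hi⟩ := hn
  cases t
  · exact Fin.elim0 j
  · exact absurd (Subsingleton.elim (α := Fin 1) i j ▸ hi) hj
  · by_cases h0 : (0 : Fin 2) ∈ S
    · refine ⟨_, isDegenerateFace_D_one (Or.inl rfl) h0 fun h1 => ?_⟩
      match j with
      | (0 : Fin 2) => exact hj h0
      | (1 : Fin 2) => exact hj h1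
    · refine ⟨_, isDegenerateFace_D_zero h0 ?_⟩
      match i with
      | (0 : Fin 2) => exact absurd hi h0
      | (1 : Fin 2) => exact hi

/-- The only nondegenerate front faces of a cell are those which contain each factor either with
all its coordinates or with none. -/
theorem Cell.face_zero_degenerate (w : Cell K) (H : Finset (Fin w.cube.1))
    (hH : H ∉ w.support.powerset.image w.coords) : (w.cube.face H 0).Degenerate := by
  suffices h : ∃ i, (∃ j, w.coord i j ∉ H) ∧ ∃ j, w.coord i j ∈ H by
    obtain ⟨i, hu, hn⟩ := h
    obtain ⟨j, hj⟩ := (w.1 i).isDegenerateFace_zero {j | w.coord i j ∈ H} hu hn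
    exact w.face_degenerate H 0 hj
  by_contra! h
  -- otherwise `H` consists of all the coordinates of the factors that it meets
  refine hH (Finset.mem_image.2
    ⟨Finset.univ.filter fun i => ∃ j, w.coord i j ∈ H, Finset.mem_powerset.2 fun i hi => ?_, ?_⟩)
  · obtain ⟨j, -⟩ := (Finset.mem_filter.1 hi).2
    rw [Cell.mem_support]
    intro h1
    rw [h1] at j
    exact Fin.elim0 j
  · ext c
    obtain ⟨i, j, rfl⟩ := w.coord_surjective c
    rw [Cell.coord_mem_coords, Finset.mem_filter]
    refine ⟨fun ⟨_, j', hj'⟩ => ?_, fun hj => ⟨Finset.mem_univ _, j, hj⟩⟩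
    by_contra hj
    exact h i ⟨j, hj⟩ j' hj'

theorem CellType.neg_one_pow_dim_mul_dim (t t' : CellType) :
    (-1 : k) ^ (t.dim * t'.dim) =
      (-1) ^ ((if t = .T then 1 else 0) * (if t' = .T then 1 else 0)) := by
  cases t <;> cases t' <;> simp [CellType.dim]
  exact Even.neg_one_pow ⟨2, rfl⟩

/-- The sign of a shuffle of the factors counts only the inversions among circles. -/
theorem Cell.shuffleSign_coords (w : Cell K) (P : Finset (Fin m)) :
    shuffleSign k (w.coords P) = (-1) ^ ((letters (w.restrict P).1 .T ×ˢ
      letters (w.restrict Pᶜ).1 .T).filter fun p => p.2 < p.1).card := by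
  have h1 : (Finset.univ.filter fun p : Fin w.cube.1 × Fin w.cube.1 =>
      p.1 ∈ w.coords P ∧ p.2 ∉ w.coords P ∧ p.2 < p.1).card =
      ∑ i, ∑ i', if i ∈ P ∧ i' ∉ P ∧ i' < i then (w.1 i).dim * (w.1 i').dim else 0 := by
    rw [Finset.card_filter, ← Finset.univ_product_univ, Finset.sum_product, Cell.sum_coord]
    refine Finset.sum_congr rfl fun i _ => ?_
    simp only [Cell.sum_coord w, Cell.coord_mem_coords]
    rw [Finset.sum_comm]
    refine Finset.sum_congr rfl fun i' _ => ?_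
    have : ∀ (j : Fin (w.1 i).dim) (j' : Fin (w.1 i').dim),
        (i ∈ P ∧ i' ∉ P ∧ w.coord i' j' < w.coord i j) ↔ (i ∈ P ∧ i' ∉ P ∧ i' < i) := by
      refine fun j j' => and_congr_right fun hi => and_congr_right fun hi' => ?_
      exact w.coord_lt_iff (fun h : i' = i => hi' (by rw [h]; exact hi)) j' j
    simp only [this]
    split_ifs <;> simp
  have h2 : ∀ Q : Finset (Fin m), letters (w.restrict Q).1 .T =
      Finset.univ.filter fun i => i ∈ Q ∧ w.1 i = .T := by
    intro Q
    ext i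
    rw [letters, Finset.mem_filter, Finset.mem_filter, Cell.restrict_apply]
    split_ifs with h <;> simp [h]
  have h3 : ((letters (w.restrict P).1 .T ×ˢ
      letters (w.restrict Pᶜ).1 .T).filter fun p => p.2 < p.1).card =
      ∑ i, ∑ i', if i ∈ P ∧ i' ∉ P ∧ i' < i then
        (if w.1 i = .T then 1 else 0) * (if w.1 i' = .T then 1 else 0) else 0 := by
    rw [Finset.card_filter, Finset.sum_product, h2, h2, Finset.sum_filter]
    refine Finset.sum_congr rfl fun i _ => ?_
    rw [Finset.sum_filter]
    by_cases hi : i ∈ P ∧ w.1 i = .T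
    · rw [if_pos hi]
      refine Finset.sum_congr rfl fun i' _ => ?_
      by_cases hP' : i' ∈ P <;> by_cases hi' : w.1 i' = .T <;> simp [hi, hP', hi']
    · rw [if_neg hi]
      refine (Finset.sum_eq_zero fun i' _ => ?_).symm
      by_cases hP : i ∈ P
      · rw [if_neg fun h => hi ⟨hP, h⟩, zero_mul, ite_self]
      · rw [if_neg fun h => hP h.1]
  rw [shuffleSign, h1, h3, ← Finset.prod_pow_eq_pow_sum, ← Finset.prod_pow_eq_pow_sum]
  refine Finset.prod_congr rfl fun i _ => ?_
  rw [← Finset.prod_pow_eq_pow_sum, ← Finset.prod_pow_eq_pow_sum]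
  refine Finset.prod_congr rfl fun i' _ => ?_
  by_cases h : i ∈ P ∧ i' ∉ P ∧ i' < i
  · rw [if_pos h, if_pos h, CellType.neg_one_pow_dim_mul_dim]
  · rw [if_neg h, if_neg h]

/-- The product of cellular cochains: the factors of a cell are distributed among the two cochains,
and the sign is that of the resulting shuffle of the circles. -/
theorem cellMul_eq_sum (f g : CellCochain K k) (w : Cell K) :
    cellMul K k f g w = ∑ P ∈ w.support.powerset,
      (-1) ^ ((letters (w.restrict P).1 .T ×ˢ
        letters (w.restrict Pᶜ).1 .T).filter fun p => p.2 < p.1).card *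
      (f (w.restrict P) * g (w.restrict Pᶜ)) := by
  rw [cellMul_apply,
    ← Finset.sum_subset (Finset.subset_univ (w.support.powerset.image w.coords)),
    Finset.sum_image w.coords_injOn]
  · refine Finset.sum_congr rfl fun P _ => ?_
    rw [w.shuffleSign_coords k P, w.compl_coords, w.face_coords P (Or.inl rfl),
      w.face_coords Pᶜ (Or.inr rfl), cellExtend_cube, cellExtend_cube]
  · intro H _ hH
    rw [cellExtend_degenerate k f (w.face_zero_degenerate H hH), zero_mul, mul_zero]

end CellularFormulas

/-! ### Cells and monomials -/

section Letters

variable {m : ℕ} {K : SimplicialComplexOn m}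

theorem mem_letters {w : Fin m → CellType} {t : CellType} {i : Fin m} :
    i ∈ letters w t ↔ w i = t := by
  simp [letters]

theorem disjoint_letters (w : Fin m → CellType) : Disjoint (letters w .D) (letters w .T) := by
  refine Finset.disjoint_left.2 fun i h h' => ?_
  rw [mem_letters] at h h'
  rw [h] at h'
  exact absurd h' (by decide)

theorem cellDT_apply (I J : Finset (Fin m)) (hI : I ∈ K.faces) (i : Fin m) :
    (cellDT I J hI).1 i = if i ∈ I then .D else if i ∈ J then .T else .one := rfl

theorem letters_cellDT_D (I J : Finset (Fin m)) (hI : I ∈ K.faces) :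
    letters (cellDT I J hI).1 .D = I := by
  ext i
  rw [mem_letters, cellDT_apply]
  split_ifs <;> simp_all

theorem letters_cellDT_T {I J : Finset (Fin m)} (hI : I ∈ K.faces) (hIJ : Disjoint I J) :
    letters (cellDT I J hI).1 .T = J := by
  ext i
  have : i ∈ I → i ∉ J := fun h => Finset.disjoint_left.1 hIJ h
  rw [mem_letters, cellDT_apply]
  split_ifs <;> simp_all

theorem cellDT_letters (w : Cell K) : cellDT (letters w.1 .D) (letters w.1 .T) w.2 = w := by
  refine Subtype.ext (funext fun i => ?_)
  simp only [cellDT_apply, mem_letters]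
  cases w.1 i <;> simp

theorem card_letters (w : Fin m → CellType) (t : CellType) :
    (letters w t).card = ∑ i, if w i = t then 1 else 0 :=
  Finset.card_filter _ _

theorem Cell.dim_eq (w : Cell K) : w.dim = (letters w.1 .T).card + 2 * (letters w.1 .D).card := by
  rw [card_letters, card_letters, Finset.mul_sum, ← Finset.sum_add_distrib]
  refine Finset.sum_congr rfl fun i _ => ?_
  cases w.1 i <;> simp [CellType.dim]

theorem degree_sqfree (I : Finset (Fin m)) : (sqfree I).degree = I.card := by
  rw [sqfree, map_sum]
  simp

instance : Finite CellType :=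
  Finite.of_injective (fun t : CellType => (⟨t.dim, by cases t <;> decide⟩ : Fin 3)) (by
    intro s t h
    cases s <;> cases t <;> simp_all [CellType.dim])

end Letters

section Isomorphism

variable (k : Type*) [CommRing k] {m : ℕ} (K : SimplicialComplexOn m)

/-! ### The isomorphism of `A^*(K)` with the cellular cochains -/

/-- The linear map on `Λ[u_1, …, u_m] ⊗ k(K)` that takes `v_I u_J`, for disjoint `I` and `J`, to
the cochain dual to the cell `D_I T_J`, and the monomials outside `A^*(K)` to zero. -/
def koszulToCell : Koszul k K →ₗ[k] CellCochain K k :=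
  LinearMap.pi fun w => koszulCoeff k K (letters w.1 .T) (letters w.1 .D) w.2

theorem koszulToCell_koszulMonomial (J : Finset (Fin m)) (α : Fin m →₀ ℕ) (w : Cell K) :
    koszulToCell k K (koszulMonomial k K J α) w =
      if J = letters w.1 .T ∧ α = sqfree (letters w.1 .D) then 1 else 0 :=
  koszulCoeff_koszulMonomial k K _ _ _ _ _

theorem koszulToCell_sqfree_letters (w : Cell K) :
    koszulToCell k K (koszulMonomial k K (letters w.1 .T) (sqfree (letters w.1 .D))) =
      dualCell K k w := by
  funext w'
  rw [koszulToCell_koszulMonomial, dualCell, Pi.single_apply]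
  refine if_congr ⟨fun h => ?_, ?_⟩ rfl rfl
  · rw [← cellDT_letters w, ← cellDT_letters w']
    simp only [h.1, sqfree_injective h.2]
  · rintro rfl
    exact ⟨rfl, rfl⟩

theorem koszulToCell_sqfree {I J : Finset (Fin m)} (hI : I ∈ K.faces) (hIJ : Disjoint I J) :
    koszulToCell k K (koszulMonomial k K J (sqfree I)) = dualCell K k (cellDT I J hI) := by
  rw [← koszulToCell_sqfree_letters, letters_cellDT_D, letters_cellDT_T hI hIJ]

/-- No cell corresponds to a monomial with defects. -/
theorem koszulToCell_of_mem_nonSqfree {x : Koszul k K} (hx : x ∈ nonSqfree k K) :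
    koszulToCell k K x = 0 := by
  refine (Submodule.span_le (p := LinearMap.ker (koszulToCell k K))).2 ?_ hx
  rintro _ ⟨J, α, ⟨i, hi⟩, rfl⟩
  refine LinearMap.mem_ker.2 (funext fun w => ?_)
  rw [koszulToCell_koszulMonomial, if_neg, Pi.zero_apply]
  rintro ⟨rfl, rfl⟩
  have := defectSet_sqfree (disjoint_letters w.1)
  exact Finset.notMem_empty i (this ▸ mem_defectSet.2 hi)

theorem koszulToCell_projA (x : Koszul k K) :
    koszulToCell k K (projA k K x) = koszulToCell k K x := by
  refine (sub_eq_zero.1 ?_).symm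
  rw [← map_sub]
  exact koszulToCell_of_mem_nonSqfree k K (sub_projA_mem k K x)

/-- Two linear maps on `A^*(K)` are equal if they agree on the monomials `v_I u_J`. -/
theorem A_hom_ext {M : Type*} [AddCommGroup M] [Module k M] {f g : A k K →ₗ[k] M}
    (h : ∀ I J hI hIJ, f (monA k K I J hI hIJ) = g (monA k K I J hI hIJ)) : f = g := by
  have hp : f ∘ₗ projA k K = g ∘ₗ projA k K := by
    refine koszul_hom_ext k K fun J α => ?_
    rw [LinearMap.comp_apply, LinearMap.comp_apply]
    by_cases hd : defectSet J α = ∅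
    · obtain ⟨h1, h2⟩ := eq_sqfree_of_defectSet_eq_empty hd
      by_cases hα : α.support ∈ K.faces
      · have : projA k K (koszulMonomial k K J α) = monA k K α.support J hα h2 := by
          refine Subtype.ext ?_
          rw [projA_koszulMonomial, if_pos hd]
          exact congrArg (koszulMonomial k K J) h1
        rw [this, h]
      · rw [koszulMonomial_eq_zero k K J hα, map_zero, map_zero, map_zero]
    · rw [(projA_eq_zero_iff k K).2 (koszulMonomial_mem_nonSqfree k K
        (Finset.nonempty_iff_ne_empty.2 hd)), map_zero, map_zero]
  ext a
  rw [← projA_coe k K a]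
  exact LinearMap.congr_fun hp a

/-- The isomorphism `v_I u_J ↦ (D_I T_J)^*` of `A^*(K)` with the cellular cochains. -/
def cellEquiv : A k K ≃ₗ[k] CellCochain K k :=
  LinearEquiv.ofLinearMap (koszulToCell k K ∘ₗ (A k K).subtype)
    ((Pi.basisFun k (Cell K)).constr k fun w =>
      monA k K (letters w.1 .D) (letters w.1 .T) w.2 (disjoint_letters w.1))
    (by
      refine (Pi.basisFun k (Cell K)).ext fun w => ?_
      rw [LinearMap.comp_apply, Module.Basis.constr_basis, LinearMap.id_apply,
        LinearMap.comp_apply, Pi.basisFun_apply]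
      exact koszulToCell_sqfree_letters k K w)
    (by
      refine A_hom_ext k K fun I J hI hIJ => ?_
      rw [LinearMap.comp_apply, LinearMap.comp_apply, Submodule.subtype_apply, monA,
        koszulToCell_sqfree k K hI hIJ, dualCell, ← Pi.basisFun_apply k,
        Module.Basis.constr_basis, LinearMap.id_apply]
      refine Subtype.ext ?_
      simp only [monA, letters_cellDT_D, letters_cellDT_T hI hIJ])

theorem cellEquiv_apply (a : A k K) : cellEquiv k K a = koszulToCell k K a := rfl

theorem cellEquiv_monA {I J : Finset (Fin m)} (hI : I ∈ K.faces) (hIJ : Disjoint I J) :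
    cellEquiv k K (monA k K I J hI hIJ) = dualCell K k (cellDT I J hI) :=
  koszulToCell_sqfree k K hI hIJ

theorem cellEquiv_oneA : cellEquiv k K (oneA k K) = cellOne K k := by
  rw [oneA, cellEquiv_monA]
  funext w
  rw [dualCell, Pi.single_apply, cellOne]
  refine if_congr ⟨?_, fun h => ?_⟩ rfl rfl
  · rintro rfl
    exact Finset.sum_eq_zero fun i _ => by simp [cellDT_apply, CellType.dim]
  · rw [Cell.dim_eq] at h
    have h1 : letters w.1 .T = ∅ := Finset.card_eq_zero.1 (by omega)
    have h2 : letters w.1 .D = ∅ := Finset.card_eq_zero.1 (by omega)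
    rw [← cellDT_letters w]
    simp only [h1, h2]

/-- The pairs of complementary faces of a cell `w`, the first of which is `D_I T_J` and the second
`D_I' T_J'`, correspond to factorizations of the monomial of `w`. -/
theorem restrict_eq_iff {I J I' J' : Finset (Fin m)} (hI : I ∈ K.faces) (hI' : I' ∈ K.faces)
    (hIJ : Disjoint I J) (hIJ' : Disjoint I' J') (w : Cell K) {P : Finset (Fin m)}
    (hP : P ⊆ w.support) :
    (w.restrict P = cellDT I J hI ∧ w.restrict Pᶜ = cellDT I' J' hI') ↔
      P = I ∪ J ∧ Disjoint J J' ∧ J ∪ J' = letters w.1 .T ∧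
        sqfree I + sqfree I' = sqfree (letters w.1 .D) := by
  -- both sides are conditions on the factors, one for each place
  have key : ∀ (t : CellType) (p a b a' b' : Prop) [Decidable p] [Decidable a] [Decidable b]
      [Decidable a'] [Decidable b'], (a → ¬ b) → (a' → ¬ b') → (p → t ≠ .one) →
      (((if p then t else .one) = (if a then CellType.D else if b then .T else .one) ∧
        (if ¬ p then t else .one) = (if a' then CellType.D else if b' then .T else .one)) ↔
      ((p ↔ a ∨ b) ∧ (b → ¬ b') ∧ ((b ∨ b') ↔ t = .T) ∧
        (if a then 1 else 0) + (if a' then 1 else 0) = if t = .D then 1 else 0)) := by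
    intro t p a b a' b' _ _ _ _ _ h1 h2 h3
    cases t <;> by_cases p <;> by_cases a <;> by_cases b <;> by_cases a' <;> by_cases b' <;>
      simp_all
  have key' := fun i => key (w.1 i) (i ∈ P) (i ∈ I) (i ∈ J) (i ∈ I') (i ∈ J')
    (fun h => Finset.disjoint_left.1 hIJ h) (fun h => Finset.disjoint_left.1 hIJ' h)
    (fun h => Cell.mem_support.1 (hP h))
  rw [Subtype.ext_iff, Subtype.ext_iff, funext_iff, funext_iff, ← forall_and, Finset.ext_iff,
    Finset.disjoint_left, Finset.ext_iff, DFunLike.ext_iff]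
  simp only [Cell.restrict_apply, cellDT_apply, Finset.mem_compl, key', forall_and,
    Finset.mem_union, mem_letters, Finsupp.add_apply, sqfree_apply]

theorem cellEquiv_mulA (a b : A k K) :
    cellEquiv k K (mulA k K a b) = cellMul K k (cellEquiv k K a) (cellEquiv k K b) := by
  suffices h : (mulA k K).compr₂ (cellEquiv k K : A k K →ₗ[k] CellCochain K k) =
      (cellMul K k).compl₁₂ (cellEquiv k K : A k K →ₗ[k] CellCochain K k)
        (cellEquiv k K : A k K →ₗ[k] CellCochain K k) from
    LinearMap.congr_fun (LinearMap.congr_fun h a) b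
  refine A_hom_ext k K fun I J hI hIJ => A_hom_ext k K fun I' J' hI' hIJ' => ?_
  rw [LinearMap.compr₂_apply, LinearMap.compl₁₂_apply, LinearEquiv.coe_coe, cellEquiv_monA,
    cellEquiv_monA, cellEquiv_apply, mulA_apply, koszulToCell_projA, monA, monA,
    koszulMonomial_mul]
  funext w
  rw [cellMul_eq_sum]
  have hterm : ∀ P ∈ w.support.powerset,
      (-1 : k) ^ ((letters (w.restrict P).1 .T ×ˢ
        letters (w.restrict Pᶜ).1 .T).filter fun p => p.2 < p.1).card *
      (dualCell K k (cellDT I J hI) (w.restrict P) *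
        dualCell K k (cellDT I' J' hI') (w.restrict Pᶜ)) =
      if P = I ∪ J ∧ Disjoint J J' ∧ J ∪ J' = letters w.1 .T ∧
        sqfree I + sqfree I' = sqfree (letters w.1 .D) then
        (-1 : k) ^ ((J ×ˢ J').filter fun p => p.2 < p.1).card else 0 := by
    intro P hP
    rw [dualCell, dualCell, Pi.single_apply, Pi.single_apply, ite_zero_mul_ite_zero, one_mul]
    have hiff := restrict_eq_iff K hI hI' hIJ hIJ' w (Finset.mem_powerset.1 hP)
    by_cases h : w.restrict P = cellDT I J hI ∧ w.restrict Pᶜ = cellDT I' J' hI'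
    · rw [if_pos h, if_pos (hiff.1 h), h.1, h.2, letters_cellDT_T hI hIJ,
        letters_cellDT_T hI' hIJ', mul_one]
    · rw [if_neg h, if_neg fun h' => h (hiff.2 h'), mul_zero]
  rw [Finset.sum_congr rfl hterm]
  -- at most the summand `P = I ∪ J` does not vanish
  by_cases hC : Disjoint J J' ∧ J ∪ J' = letters w.1 .T ∧
      sqfree I + sqfree I' = sqfree (letters w.1 .D)
  · have hmem : I ∪ J ∈ w.support.powerset := by
      refine Finset.mem_powerset.2 fun i hi => Cell.mem_support.2 fun h => ?_
      have h1 := DFunLike.congr_fun hC.2.2 i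
      have h2 := Finset.ext_iff.1 hC.2.1 i
      simp only [Finsupp.add_apply, sqfree_apply, mem_letters, h] at h1
      rw [Finset.mem_union, mem_letters, h] at h2
      rcases Finset.mem_union.1 hi with hi | hi
      · simp [hi] at h1
      · simp [hi] at h2
    rw [Finset.sum_eq_single_of_mem _ hmem fun P _ hP => if_neg fun h => hP h.1,
      if_pos hC.1, if_pos (And.intro (Eq.refl (I ∪ J)) hC), map_smul, Pi.smul_apply,
      koszulToCell_koszulMonomial, if_pos hC.2, smul_eq_mul, mul_one]
  · rw [Finset.sum_eq_zero fun P _ => if_neg fun h => hC h.2]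
    split_ifs with hJ
    · rw [map_smul, Pi.smul_apply, koszulToCell_koszulMonomial, if_neg fun h => hC ⟨hJ, h⟩,
        smul_zero]
    · rw [map_zero, Pi.zero_apply]

/-- The summand of `d (v_I u_J)` in which `u_i` is replaced by `v_i` is the monomial of the cell
`w` exactly when `D_I T_J` is the face of `w` in which the disk with the number `i` is replaced by
its boundary circle. -/
theorem circleAt_eq_iff {I J : Finset (Fin m)} (hI : I ∈ K.faces) (hIJ : Disjoint I J)
    (w : Cell K) (i : Fin m) :
    (w.1 i = .D ∧ w.circleAt i = cellDT I J hI) ↔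
      (i ∈ J ∧ J.erase i = letters w.1 .T ∧
        sqfree I + Finsupp.single i 1 = sqfree (letters w.1 .D)) := by
  -- both sides are conditions on the factors, one for each place
  have key : ∀ (t : CellType) (p a b : Prop) [Decidable p] [Decidable a] [Decidable b],
      (a → ¬ b) → ((p → t = .D) ∧
        (if p then .T else t) = (if a then CellType.D else if b then .T else .one) ↔
      ((p → b) ∧ ((¬ p ∧ b) ↔ t = .T) ∧
        (if a then 1 else 0) + (if p then 1 else 0) = if t = .D then 1 else 0)) := by
    intro t p a b _ _ _ h1
    cases t <;> by_cases p <;> by_cases a <;> by_cases b <;> simp_all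
  have key' := fun l => key (w.1 l) (l = i) (l ∈ I) (l ∈ J)
    (fun h => Finset.disjoint_left.1 hIJ h)
  have h1 : w.1 i = .D ↔ ∀ l, l = i → w.1 l = .D := by simp
  have h2 : i ∈ J ↔ ∀ l, l = i → l ∈ J := by simp
  rw [h1, h2, Subtype.ext_iff, funext_iff, ← forall_and, Finset.ext_iff, DFunLike.ext_iff]
  simp only [Cell.circleAt_apply, cellDT_apply, key', forall_and, Finset.mem_erase, ne_eq,
    mem_letters, Finsupp.add_apply, sqfree_apply, Finsupp.single_apply, eq_comm (a := i)]

theorem cellEquiv_dA (a : A k K) : cellEquiv k K (dA k K a) = cellD K k (cellEquiv k K a) := by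
  suffices h : (cellEquiv k K : A k K →ₗ[k] CellCochain K k) ∘ₗ dA k K =
      cellD K k ∘ₗ (cellEquiv k K : A k K →ₗ[k] CellCochain K k) from LinearMap.congr_fun h a
  refine A_hom_ext k K fun I J hI hIJ => ?_
  rw [LinearMap.comp_apply, LinearMap.comp_apply, LinearEquiv.coe_coe, cellEquiv_monA,
    cellEquiv_apply, coe_dA, monA, koszulD_koszulMonomial]
  funext w
  rw [cellD_eq_sum, map_sum, Finset.sum_apply, ← Finset.sum_subset (Finset.subset_univ J)]
  · refine Finset.sum_congr rfl fun i hi => ?_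
    rw [map_smul, Pi.smul_apply, koszulToCell_koszulMonomial, dualCell, Pi.single_apply,
      smul_eq_mul, ← mul_ite_zero, ← ite_and]
    by_cases h : J.erase i = letters w.1 .T ∧
        sqfree I + Finsupp.single i 1 = sqfree (letters w.1 .D)
    · rw [if_pos h, if_pos ((circleAt_eq_iff K hI hIJ w i).2 ⟨hi, h⟩)]
      congr 3
      -- the circles of `w` are those of `D_I T_J`, except the one at the place `i`
      ext l
      have := Finset.ext_iff.1 h.1 l
      rw [Finset.mem_erase, mem_letters] at this
      rw [Finset.mem_filter, Finset.mem_filter, Finset.mem_Iio, ← this]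
      exact ⟨fun h => ⟨h.2, h.2.ne, h.1⟩, fun h => ⟨h.2.2, h.1⟩⟩
    · rw [if_neg h, if_neg fun h' => h ((circleAt_eq_iff K hI hIJ w i).1 h').2, mul_zero, mul_zero]
  · intro i _ hi
    rw [dualCell, Pi.single_apply, ← mul_ite_zero, ← ite_and,
      if_neg fun h' => hi ((circleAt_eq_iff K hI hIJ w i).1 h').1, mul_zero]

/-! ### Gradings -/

/-- The isomorphism preserves every grading in which the monomials and the cells are homogeneous
of matching degrees. -/
theorem map_cellEquiv_comap_span {P : Finset (Fin m) → (Fin m →₀ ℕ) → Prop} {Q : Cell K → Prop}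
    (h : ∀ w : Cell K, P (letters w.1 .T) (sqfree (letters w.1 .D)) ↔ Q w) :
    ((Submodule.span k {x | ∃ J α, P J α ∧ x = koszulMonomial k K J α}).comap
      (A k K).subtype).map (cellEquiv k K : A k K →ₗ[k] CellCochain K k) =
      Submodule.span k {f | ∃ w : Cell K, Q w ∧ f = dualCell K k w} := by
  refine le_antisymm (Submodule.map_le_iff_le_comap.2 fun a ha => ?_) (Submodule.span_le.2 ?_)
  · refine (Submodule.span_le (p := (Submodule.span k {f | ∃ w : Cell K, Q w ∧
      f = dualCell K k w}).comap (koszulToCell k K))).2 ?_ ha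
    rintro _ ⟨J, α, hP, rfl⟩
    rw [SetLike.mem_coe, Submodule.mem_comap]
    by_cases hw : ∃ w : Cell K, J = letters w.1 .T ∧ α = sqfree (letters w.1 .D)
    · obtain ⟨w, rfl, rfl⟩ := hw
      rw [koszulToCell_sqfree_letters]
      exact Submodule.subset_span ⟨w, (h w).1 hP, rfl⟩
    · have : koszulToCell k K (koszulMonomial k K J α) = 0 := by
        funext w
        rw [koszulToCell_koszulMonomial, if_neg fun h => hw ⟨w, h⟩, Pi.zero_apply]
      rw [this]
      exact zero_mem _
  · rintro _ ⟨w, hQ, rfl⟩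
    refine ⟨monA k K _ _ w.2 (disjoint_letters w.1), Submodule.subset_span ?_, ?_⟩
    · exact ⟨_, _, (h w).2 hQ, rfl⟩
    · exact koszulToCell_sqfree_letters k K w

theorem map_cellEquiv_degreeA (n : ℕ) :
    (degreeA k K n).map (cellEquiv k K : A k K →ₗ[k] CellCochain K k) = cellDegree K k n := by
  refine map_cellEquiv_comap_span k K fun w => ?_
  rw [degree_sqfree, Cell.dim_eq]

theorem map_cellEquiv_bidegreeA (s t : ℤ) :
    (bidegreeA k K s t).map (cellEquiv k K : A k K →ₗ[k] CellCochain K k) =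
      cellBidegree K k s t := by
  simp only [bidegreeA, koszulBidegree, cellBidegree, ← and_assoc]
  refine map_cellEquiv_comap_span k K fun w => ?_
  rw [degree_sqfree]

theorem cellEquiv_mem_cellDegree {n : ℕ} {a : A k K} :
    cellEquiv k K a ∈ cellDegree K k n ↔ a ∈ degreeA k K n := by
  rw [← map_cellEquiv_degreeA]
  exact (cellEquiv k K).injective.mem_set_image

theorem cellEquiv_mem_cellBidegree {s t : ℤ} {a : A k K} :
    cellEquiv k K a ∈ cellBidegree K k s t ↔ a ∈ bidegreeA k K s t := by
  rw [← map_cellEquiv_bidegreeA]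
  exact (cellEquiv k K).injective.mem_set_image

theorem isInternal_span_dualCell {κ : Type*} [DecidableEq κ] (deg : Cell K → κ) :
    DirectSum.IsInternal fun c : κ =>
      Submodule.span k {f | ∃ w : Cell K, deg w = c ∧ f = dualCell K k w} := by
  have h := isInternal_span_basis (Pi.basisFun k (Cell K)) deg
  simpa only [Set.image, Set.mem_ofPred_eq, Pi.basisFun_apply, dualCell, eq_comm] using h

theorem isInternal_cellDegree : DirectSum.IsInternal (cellDegree K k) :=
  isInternal_span_dualCell k K Cell.dim

theorem isInternal_cellBidegree :
    DirectSum.IsInternal fun st : ℤ × ℤ => cellBidegree K k st.1 st.2 := by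
  have h := isInternal_span_dualCell k K fun w => (-((letters w.1 .T).card : ℤ),
    2 * (((letters w.1 .T).card : ℤ) + ((letters w.1 .D).card : ℤ)))
  simpa only [cellBidegree, Prod.ext_iff, and_assoc] using h

theorem isInternal_degreeA : DirectSum.IsInternal (degreeA k K) := by
  have h := isInternal_span_basis ((Pi.basisFun k (Cell K)).map (cellEquiv k K).symm) Cell.dim
  suffices hd : degreeA k K = fun n => Submodule.span k
      ((Pi.basisFun k (Cell K)).map (cellEquiv k K).symm '' {w | Cell.dim w = n}) by
    rw [hd]
    exact h
  funext n
  refine Submodule.map_injective_of_injective (f := (cellEquiv k K : A k K →ₗ[k] CellCochain K k))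
    (cellEquiv k K).injective ?_
  rw [map_cellEquiv_degreeA, Submodule.map_span, cellDegree]
  congr 1
  ext f
  simp only [Set.mem_ofPred_eq, Set.mem_image, exists_exists_and_eq_and, Module.Basis.map_apply,
    LinearEquiv.coe_coe, LinearEquiv.apply_symm_apply, Pi.basisFun_apply, dualCell,
    eq_comm (a := f)]

/-! ### The differential graded algebra structures -/

/-- `A^*(K)` inherits the structure from the Koszul algebra, whose quotient it is. -/
theorem isDGAlgebra_A : IsDGAlgebra (degreeA k K) (oneA k K) (mulA k K) (dA k K) where
  isInternal := isInternal_degreeA k K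
  one_mem := Submodule.subset_span ⟨∅, sqfree ∅, by simp [sqfree], rfl⟩
  mul_mem ha hb := projA_mem_koszulDegree k K (mul_mem_koszulDegree k K ha hb)
  one_mul a := by rw [mulA_apply, coe_oneA, one_mul, projA_coe]
  mul_one a := by rw [mulA_apply, coe_oneA, mul_one, projA_coe]
  mul_assoc a b c := by
    rw [mulA_apply k K a b, mulA_apply k K b c, mulA_projA_left, mulA_projA_right, mul_assoc]
  d_mem ha := koszulD_mem_koszulDegree k K ha
  d_d a := Subtype.ext (koszulD_koszulD k K a)
  leibniz {p a} ha b := by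
    rw [mulA_apply k K a b, dA_projA, koszulD_mul k K (a := (a : Koszul k K)) ha, map_add, map_smul]
    rfl

/-- The structure is carried over from `A^*(K)` by the isomorphism. -/
theorem isDGAlgebra_cell :
    IsDGAlgebra (cellDegree K k) (cellOne K k) (cellMul K k) (cellD K k) where
  isInternal := isInternal_cellDegree k K
  one_mem := by
    rw [← cellEquiv_oneA, cellEquiv_mem_cellDegree]
    exact (isDGAlgebra_A k K).one_mem
  mul_mem {p q a b} ha hb := by
    obtain ⟨a, rfl⟩ := (cellEquiv k K).surjective a
    obtain ⟨b, rfl⟩ := (cellEquiv k K).surjective b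
    rw [cellEquiv_mem_cellDegree] at ha hb
    rw [← cellEquiv_mulA, cellEquiv_mem_cellDegree]
    exact (isDGAlgebra_A k K).mul_mem ha hb
  one_mul a := by
    obtain ⟨a, rfl⟩ := (cellEquiv k K).surjective a
    rw [← cellEquiv_oneA, ← cellEquiv_mulA, (isDGAlgebra_A k K).one_mul]
  mul_one a := by
    obtain ⟨a, rfl⟩ := (cellEquiv k K).surjective a
    rw [← cellEquiv_oneA, ← cellEquiv_mulA, (isDGAlgebra_A k K).mul_one]
  mul_assoc a b c := by
    obtain ⟨a, rfl⟩ := (cellEquiv k K).surjective a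
    obtain ⟨b, rfl⟩ := (cellEquiv k K).surjective b
    obtain ⟨c, rfl⟩ := (cellEquiv k K).surjective c
    simp only [← cellEquiv_mulA, (isDGAlgebra_A k K).mul_assoc]
  d_mem {p a} ha := by
    obtain ⟨a, rfl⟩ := (cellEquiv k K).surjective a
    rw [cellEquiv_mem_cellDegree] at ha
    rw [← cellEquiv_dA, cellEquiv_mem_cellDegree]
    exact (isDGAlgebra_A k K).d_mem ha
  d_d a := by
    obtain ⟨a, rfl⟩ := (cellEquiv k K).surjective a
    rw [← cellEquiv_dA, ← cellEquiv_dA, (isDGAlgebra_A k K).d_d, map_zero]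
  leibniz {p a} ha b := by
    obtain ⟨a, rfl⟩ := (cellEquiv k K).surjective a
    obtain ⟨b, rfl⟩ := (cellEquiv k K).surjective b
    rw [cellEquiv_mem_cellDegree] at ha
    simp only [← cellEquiv_mulA, ← cellEquiv_dA, (isDGAlgebra_A k K).leibniz ha, map_add, map_smul]

theorem isBigradedComplex_koszul : IsBigradedComplex (koszulBidegree k K) (koszulD k K) where
  isInternal := isInternal_koszulBidegree k K
  d_mem ha := koszulD_mem_koszulBidegree k K ha
  d_d := koszulD_koszulD k K

theorem isBigradedComplex_cell : IsBigradedComplex (cellBidegree K k) (cellD K k) where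
  isInternal := isInternal_cellBidegree k K
  d_mem {s t a} ha := by
    obtain ⟨a, rfl⟩ := (cellEquiv k K).surjective a
    rw [cellEquiv_mem_cellBidegree] at ha
    rw [← cellEquiv_dA, cellEquiv_mem_cellBidegree]
    exact koszulD_mem_koszulBidegree k K ha
  d_d := (isDGAlgebra_cell k K).d_d

/-! ### The isomorphism in cohomology -/

theorem cellEquiv_symm_cellD (f : CellCochain K k) :
    (cellEquiv k K).symm (cellD K k f) = dA k K ((cellEquiv k K).symm f) := by
  rw [LinearEquiv.symm_apply_eq, cellEquiv_dA, LinearEquiv.apply_symm_apply]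

theorem cellEquiv_symm_mem_koszulBidegree {s t : ℤ} {f : CellCochain K k}
    (hf : f ∈ cellBidegree K k s t) :
    ((cellEquiv k K).symm f : Koszul k K) ∈ koszulBidegree k K s t := by
  refine (cellEquiv_mem_cellBidegree k K).1 ?_
  rwa [LinearEquiv.apply_symm_apply]

/-- The map `(D_I T_J)^* ↦ v_I u_J` on cocycles. -/
def cellToKoszulCocycles (s t : ℤ) :
    cocycles (cellBidegree K k) (cellD K k) s t →ₗ[k]
      cocycles (koszulBidegree k K) (koszulD k K) s t :=
  LinearMap.restrict ((A k K).subtype ∘ₗ ((cellEquiv k K).symm : CellCochain K k →ₗ[k] A k K))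
    fun f hf => ⟨cellEquiv_symm_mem_koszulBidegree k K hf.1, LinearMap.mem_ker.2 (by
      have h : cellD K k f = 0 := hf.2
      have := cellEquiv_symm_cellD k K f
      rw [h, map_zero] at this
      exact (congrArg Subtype.val this).symm)⟩

theorem coe_cellToKoszulCocycles (s t : ℤ) (x : cocycles (cellBidegree K k) (cellD K k) s t) :
    (cellToKoszulCocycles k K s t x : Koszul k K) =
      ((cellEquiv k K).symm (x : CellCochain K k) : A k K) := rfl

/-- A cellular cocycle is a coboundary exactly when its image in the Koszul algebra is one: the
projection onto `A^*(K)` commutes with the differentials. -/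
theorem cellToKoszulCocycles_mem_coboundaries_iff (s t : ℤ)
    (x : cocycles (cellBidegree K k) (cellD K k) s t) :
    cellToKoszulCocycles k K s t x ∈ coboundaries (koszulBidegree k K) (koszulD k K) s t ↔
      x ∈ coboundaries (cellBidegree K k) (cellD K k) s t := by
  constructor
  · rintro ⟨z, hz, hzx⟩
    rw [Submodule.subtype_apply, coe_cellToKoszulCocycles] at hzx
    refine ⟨cellEquiv k K (projA k K z), ?_, ?_⟩
    · exact (cellEquiv_mem_cellBidegree k K).2 (projA_mem_koszulBidegree k K hz)
    · rw [← cellEquiv_dA, dA_projA, hzx, projA_coe, LinearEquiv.apply_symm_apply]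
      rfl
  · rintro ⟨f, hf, hfx⟩
    refine ⟨(cellEquiv k K).symm f, cellEquiv_symm_mem_koszulBidegree k K hf, ?_⟩
    rw [← coe_dA, ← cellEquiv_symm_cellD, hfx]
    rfl

/-- Every cocycle of the Koszul algebra is cohomologous to its projection onto `A^*(K)`. -/
theorem exists_sub_mem_coboundaries (s t : ℤ)
    (y : cocycles (koszulBidegree k K) (koszulD k K) s t) :
    ∃ x, y - cellToKoszulCocycles k K s t x ∈
      coboundaries (koszulBidegree k K) (koszulD k K) s t := by
  have hy : koszulD k K y = 0 := y.2.2
  refine ⟨⟨cellEquiv k K (projA k K y), ?_, LinearMap.mem_ker.2 ?_⟩,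
    koszulHomotopy k K y, koszulHomotopy_mem_koszulBidegree k K y.2.1, ?_⟩
  · exact (cellEquiv_mem_cellBidegree k K).2 (projA_mem_koszulBidegree k K y.2.1)
  · rw [← cellEquiv_dA, dA_projA, hy, map_zero, map_zero]
  · have h := koszulD_koszulHomotopy_add k K y
    rw [hy, map_zero, add_zero] at h
    rw [h, Submodule.subtype_apply, Submodule.coe_sub, coe_cellToKoszulCocycles,
      LinearEquiv.symm_apply_apply]

theorem exists_cohomologyEquiv (s t : ℤ) :
    ∃ e : bigradedCohomology (cellBidegree K k) (cellD K k) s t ≃ₗ[k]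
        bigradedCohomology (koszulBidegree k K) (koszulD k K) s t,
      ∀ (x : cocycles (cellBidegree K k) (cellD K k) s t)
        (y : cocycles (koszulBidegree k K) (koszulD k K) s t),
        (y : Koszul k K) = ((cellEquiv k K).symm (x : CellCochain K k) : A k K) →
          e (Submodule.Quotient.mk x) = Submodule.Quotient.mk y := by
  refine ⟨LinearEquiv.ofBijective (Submodule.mapQ (coboundaries (cellBidegree K k) (cellD K k) s t)
    (coboundaries (koszulBidegree k K) (koszulD k K) s t) (cellToKoszulCocycles k K s t) fun x hx =>
    Submodule.mem_comap.2 ((cellToKoszulCocycles_mem_coboundaries_iff k K s t x).2 hx))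
      ⟨?_, ?_⟩, ?_⟩
  · rw [injective_iff_map_eq_zero]
    intro x hx
    obtain ⟨x, rfl⟩ := Submodule.Quotient.mk_surjective _ x
    rw [Submodule.mapQ_apply, Submodule.Quotient.mk_eq_zero,
      cellToKoszulCocycles_mem_coboundaries_iff] at hx
    exact (Submodule.Quotient.mk_eq_zero _).2 hx
  · intro y
    obtain ⟨y, rfl⟩ := Submodule.Quotient.mk_surjective _ y
    obtain ⟨x, hx⟩ := exists_sub_mem_coboundaries k K s t y
    refine ⟨Submodule.Quotient.mk x, ?_⟩
    rw [Submodule.mapQ_apply]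
    exact ((Submodule.Quotient.eq _).2 hx).symm
  · intro x y hxy
    exact congrArg Submodule.Quotient.mk (Subtype.ext hxy.symm)

end Isomorphism

end MomentAngle

end

theorem theorem4p7 {k : Type*} [CommRing k] {m : ℕ} (K : MomentAngle.SimplicialComplexOn m) :
    -- the cellular cochain algebra is a quotient of the singular cubical cochain algebra of `Z_K`
    (∀ F G : MomentAngle.Cube (MomentAngle.momentAngle K) → k,
      MomentAngle.IsNormalized F → MomentAngle.IsNormalized G →
        MomentAngle.cellRestrict K k (MomentAngle.cubeCoboundary k F) =
          MomentAngle.cellD K k (MomentAngle.cellRestrict K k F) ∧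
        MomentAngle.cellRestrict K k (MomentAngle.cubeCup k F G) =
          MomentAngle.cellMul K k (MomentAngle.cellRestrict K k F)
            (MomentAngle.cellRestrict K k G)) ∧
    -- both sides are differential graded algebras
    MomentAngle.IsDGAlgebra (MomentAngle.degreeA k K) (MomentAngle.oneA k K)
      (MomentAngle.mulA k K) (MomentAngle.dA k K) ∧
    MomentAngle.IsDGAlgebra (MomentAngle.cellDegree K k) (MomentAngle.cellOne K k)
      (MomentAngle.cellMul K k) (MomentAngle.cellD K k) ∧
    -- both sides of the additive statement are bigraded complexes
    MomentAngle.IsBigradedComplex (MomentAngle.koszulBidegree k K) (MomentAngle.koszulD k K) ∧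
    MomentAngle.IsBigradedComplex (MomentAngle.cellBidegree K k) (MomentAngle.cellD K k) ∧
    -- the isomorphism of differential graded algebras
    ∃ φ : MomentAngle.A k K ≃ₗ[k] MomentAngle.CellCochain K k,
      (∀ (I J : Finset (Fin m)) (hI : I ∈ K.faces) (hIJ : Disjoint I J),
        φ (MomentAngle.monA k K I J hI hIJ) =
          MomentAngle.dualCell K k (MomentAngle.cellDT I J hI)) ∧
      φ (MomentAngle.oneA k K) = MomentAngle.cellOne K k ∧
      (∀ a b : MomentAngle.A k K,
        φ (MomentAngle.mulA k K a b) = MomentAngle.cellMul K k (φ a) (φ b)) ∧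
      (∀ a : MomentAngle.A k K, φ (MomentAngle.dA k K a) = MomentAngle.cellD K k (φ a)) ∧
      (∀ n : ℕ, (MomentAngle.degreeA k K n).map (φ : MomentAngle.A k K →ₗ[k] _) =
        MomentAngle.cellDegree K k n) ∧
      (∀ s t : ℤ, (MomentAngle.bidegreeA k K s t).map (φ : MomentAngle.A k K →ₗ[k] _) =
        MomentAngle.cellBidegree K k s t) ∧
      -- the induced isomorphism in bigraded cohomology
      ∀ s t : ℤ, ∃ e :
        MomentAngle.bigradedCohomology (MomentAngle.cellBidegree K k) (MomentAngle.cellD K k) s t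
          ≃ₗ[k]
        MomentAngle.bigradedCohomology (MomentAngle.koszulBidegree k K)
          (MomentAngle.koszulD k K) s t,
        ∀ (x : MomentAngle.cocycles (MomentAngle.cellBidegree K k) (MomentAngle.cellD K k) s t)
          (y : MomentAngle.cocycles (MomentAngle.koszulBidegree k K)
            (MomentAngle.koszulD k K) s t),
          (y : MomentAngle.Koszul k K) = (φ.symm (x : MomentAngle.CellCochain K k) :
              MomentAngle.A k K) →
            e (Submodule.Quotient.mk x) = Submodule.Quotient.mk y := by
  refine ⟨fun F G hF hG => ⟨MomentAngle.cellRestrict_cubeCoboundary k hF,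
      MomentAngle.cellRestrict_cubeCup k hF hG⟩,
    MomentAngle.isDGAlgebra_A k K, MomentAngle.isDGAlgebra_cell k K,
    MomentAngle.isBigradedComplex_koszul k K, MomentAngle.isBigradedComplex_cell k K,
    MomentAngle.cellEquiv k K, fun I J hI hIJ => MomentAngle.cellEquiv_monA k K hI hIJ,
    MomentAngle.cellEquiv_oneA k K, MomentAngle.cellEquiv_mulA k K, MomentAngle.cellEquiv_dA k K,
    MomentAngle.map_cellEquiv_degreeA k K, MomentAngle.map_cellEquiv_bidegreeA k K,
    MomentAngle.exists_cohomologyEquiv k K⟩
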